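/- **Setting.** Let $(\mathcal U,d)$ be a metric space and $X\subseteq\mathcal U$ a set of points, each with an arrival time $t_{\rm arr}(p)\in\mathbb N$ and a deletion time $t_{\rm del}(p)\in\mathbb N$, $t_{\rm arr}(p)<t_{\rm del}(p)$, arrival times being pairwise distinct. Let $X_t=\{p\in X: t_{\rm arr}(p)\le t<t_{\rm del}(p)\}$, let $d_{\min},d_{\max}$ be the (attained) minimum and maximum distance between two different points of $X$, and let $\Delta=d_{\max}/d_{\min}$. Deletion times are always compared with ties broken by arrival time. Let $k\ge 1$, $\varepsilon>0$, $\beta=\varepsilon/2$ and $\Gamma=\{(1+\beta)^i: i\in\mathbb Z,\ \lfloor\log_{1+\beta}d_{\min}\rfloor\le i\le\lceil\log_{1+\beta}d_{\max}\rceil\}$. **Algorithm.** For each $\gamma\in\Gamma$ one maintains an ordered list of clusters $D_1,\dots,D_\ell$ $(\ell\le k)$ with centers $c_i\in D_i$, and a set $U$ of unclustered points (as doubly linked lists with pointers from the queue entries). A point $x\in D_i$ is persistent if it is deleted after $c_i$ and vanishing otherwise; the numbers $|P_i|$, $|V_i|$ of persistent and vanishing points of $D_i$ are kept in counters. "Carving"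 a cluster out of a set $S$ means: the point $u\in S$ deleted last becomes the center of a new last cluster, and $u$ and all points of $S$ at distance at most $2\gamma$ from $u$ move from $S$ to that cluster. * $\textsc{Reclustering}(\gamma)$: let $i$ be the smallest index with $\sum_{j\ge i}|P_j|>|U|+\sum_{j\ge i}|V_j|$. If there is one, put $U'=U\cup\bigcup_{j\ge i}D_j$, remove the clusters $D_j$, $j\ge i$, carve clusters out of $U'$ one after the other until $U'=\emptyset$ or there are $k$ clusters, and set $U$ to what remains of $U'$. * $\textsc{Insert}(p,\gamma)$: put $p$ in the first cluster with $d(p,c_i)\le2\gamma$; if there is none, make $p$ the center of a new last cluster if $\ell<k$, and otherwise put $p$ in $U$. Then call $\textsc{Reclustering}(\gamma)$. * $\textsc{Delete}(p,\gamma)$: if $p$ is not a center, remove it. If $p=c_i$, move each $x\in D_i\setminus\{p\}$ in turn to the first $D_j$, $j>i$, with $d(x,c_j)\le2\gamma$; if there is none, make $x$ the center of a new last cluster if $\ell<k$ (with $D_i$ still counted), and otherwise put $x$ in $U$. Then remove $D_i$, renumber the clusters, and if $U\ne\emptyset$ carve one cluster out of $U$. In both cases finally call $\textsc{Reclustering}(\gamma)$.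 * $\textsc{Update}_{2+\varepsilon}(p,t)$: as long as the first point $q$ of a priority queue $Q$ (a heap, ordered by deletion time) has $t_{\rm del}(q)\le t$, remove $q$ from $Q$ and call $\textsc{Delete}(q,\gamma)$ for all $\gamma\in\Gamma$. Then, if $p\neq\textsc{null}$, call $\textsc{Insert}(p,\gamma)$ for all $\gamma\in\Gamma$ and insert $p$ in $Q$. Operations are elementary steps: a comparison of a distance with $2\gamma$ or of two deletion times, a step of a scan, an insertion in or a removal from a linked list with its counter update, the visit of a heap node. **Theorem.** Start from the empty data structure and consider any $n$ consecutive calls $\textsc{Update}_{2+\varepsilon}(p,t)$ with nondecreasing times $t$, where $p$ is either a point of $X$ with $t_{\rm arr}(p)=t$ (each point inserted at most once) or $\textsc{null}$. Let $M$ be the maximum of $|X_t|$ over the times $t$ of the calls (with $\log 0:=0$). 1. For every $E>0$ there is a constant $C$ depending only on $E$ such that, whenever $\varepsilon\le E$, the total number of operations is at most $$C\,n\Big(\log M+\Big(1+\frac{\log\Delta}{\varepsilon}\Big)k\Big),$$ and, if moreover $\varepsilon\le\log\Delta$, at most $C\,n\big(\log M+\frac{\log\Delta}{\varepsilon}k\big)$.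 2. There is an absolute constant $C_0$ such that for each guess $\gamma\in\Gamma$ the total number of operations of all calls of $\textsc{Insert}(\cdot,\gamma)$, of all calls of $\textsc{Delete}(\cdot,\gamma)$ (both including the calls of $\textsc{Reclustering}$ they make), and of all calls of $\textsc{Reclustering}(\gamma)$, is at most $C_0\,nk$ each. -/

import Mathlib

universe u v

/-! ## Counting operations -/

/-- The result of a computation together with the number of elementary operations performed. -/
structure Timed (α : Type u) where
  val : α
  ops : ℕ

namespace Timed

/-- Return a value already at hand; no operation is charged. -/
def ret {α : Type u} (a : α) : Timed α := ⟨a, 0⟩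

/-- Sequential composition: operations add up. -/
def bind {α : Type u} {β : Type v} (x : Timed α) (f : α → Timed β) : Timed β :=
  ⟨(f x.val).val, x.ops + (f x.val).ops⟩

/-- Repackage the result. -/
def map {α : Type u} {β : Type v} (f : α → β) (x : Timed α) : Timed β := ⟨f x.val, x.ops⟩

/-- Perform `c` elementary operations and continue with `x`. -/
def step {α : Type u} (c : ℕ) (x : Timed α) : Timed α := ⟨x.val, c + x.ops⟩

end Timed

namespace LifetimeKCenter

open Timed

/-! ## Points with lifetimes -/

/-- Arrival and deletion times of the points. -/
structure Lifetimes (U : Type u) where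
  arr : U → ℕ
  del : U → ℕ

/-- The order of deletion: by deletion time, ties broken by arrival time. -/
def Lifetimes.key {U : Type u} (L : Lifetimes U) (x : U) : ℕ ×ₗ ℕ := toLex (L.del x, L.arr x)

/-- A data set in the setting with lifetimes: at most one arrival at each time, and every point
arrives strictly before it expires. -/
structure IsDataset {U : Type u} (X : Set U) (L : Lifetimes U) : Prop where
  arr_injOn : Set.InjOn L.arr X
  arr_lt_del : ∀ p ∈ X, L.arr p < L.del p

/-- The active set `X_t`. -/
def activeSet {U : Type u} (X : Set U) (L : Lifetimes U) (t : ℕ) : Set U :=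
  {p | p ∈ X ∧ L.arr p ≤ t ∧ t < L.del p}

/-- The distances between two different points of `X`. -/
def pairDistances {U : Type u} [MetricSpace U] (X : Set U) : Set ℝ :=
  {r | ∃ x ∈ X, ∃ y ∈ X, x ≠ y ∧ r = dist x y}

/-! ## The priority queue

A heap (leftist tree) of points ordered by `Lifetimes.key`; every node stores its rank, the length
of its right spine. Each node visited while two heaps are merged costs one operation. -/

/-- Heap-shaped trees. -/
inductive Heap (U : Type u) : Type u where
  | nil : Heap U
  | node (rank : ℕ) (x : U) (l r : Heap U) : Heap U

namespace Heap

/-- The stored rank of the root. -/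
def rank {U : Type u} : Heap U → ℕ
  | nil => 0
  | node n _ _ _ => n

/-- The number of points in the heap. -/
def size {U : Type u} : Heap U → ℕ
  | nil => 0
  | node _ _ l r => l.size + r.size + 1

/-- A node with the given root and the given subtrees, the one of larger rank on the left. -/
def mk {U : Type u} (x : U) (a b : Heap U) : Heap U :=
  if b.rank ≤ a.rank then node (b.rank + 1) x a b else node (a.rank + 1) x b a

/-- Merging along the right spines. -/
def merge {U : Type u} (L : Lifetimes U) : Heap U → Heap U → Timed (Heap U)
  | nil, h => step 1 (ret h)
  | node n x l r, nil => step 1 (ret (node n x l r))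
  | node n x l r, node n' x' l' r' =>
    step 1 <|
      if L.key x ≤ L.key x' then (merge L r (node n' x' l' r')).map (mk x l)
      else (merge L (node n x l r) r').map (mk x' l')
termination_by a b => a.size + b.size
decreasing_by all_goals simp only [size]; omega

/-- Adding a point. -/
def insert {U : Type u} (L : Lifetimes U) (x : U) (h : Heap U) : Timed (Heap U) :=
  step 1 (merge L (node 1 x nil nil) h)

end Heap

/-! ## The data structure of one guess -/

/-- A cluster `D_i` with its center `c_i` (the center is a member of its own cluster) and the
counters of its persistent and of its vanishing points. -/
structure Cluster (U : Type u) where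
  center : U
  members : List U
  numPersistent : ℕ
  numVanishing : ℕ

/-- A new cluster that consists of its center only; the center counts as vanishing. -/
def Cluster.single {U : Type u} (u : U) : Cluster U := ⟨u, [u], 0, 1⟩

/-- Put `x` into a cluster and update the counters: `x` is persistent if it expires after the
center, and vanishing otherwise. -/
def Cluster.push {U : Type u} (L : Lifetimes U) (x : U) (D : Cluster U) : Cluster U :=
  if L.key D.center < L.key x then
    ⟨D.center, x :: D.members, D.numPersistent + 1, D.numVanishing⟩
  else
    ⟨D.center, x :: D.members, D.numPersistent, D.numVanishing + 1⟩

open scoped Classical in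
/-- Remove the non-central point `p` from the cluster, if it is there, and update the counters. -/
noncomputable def Cluster.unlink {U : Type u} (L : Lifetimes U) (p : U) (D : Cluster U) :
    Cluster U :=
  if p ∈ D.members then
    if L.key D.center < L.key p then
      ⟨D.center, D.members.filter (fun x => x ≠ p), D.numPersistent - 1, D.numVanishing⟩
    else
      ⟨D.center, D.members.filter (fun x => x ≠ p), D.numPersistent, D.numVanishing - 1⟩
  else D

/-- The clusters `D_1, …, D_ℓ`, in this order, and the list of unclustered points. All lists know
their lengths. -/
structure Clustering (U : Type u) where
  clusters : List (Cluster U)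
  unclustered : List U

/-- The point that is deleted last among `best` and the points of the list. -/
def pickLast {U : Type u} (L : Lifetimes U) (best : U) : List U → Timed U
  | [] => ret best
  | x :: xs => step 1 (pickLast L (if L.key best < L.key x then x else best) xs)

/-- What one scan over the clusters from the last to the first finds: the sums of the counters, and
the smallest (zero-based) index `i` such that the clusters from `i` on have together more persistent
points than there are vanishing points in them and unclustered points. -/
structure BalanceScan where
  sumPersistent : ℕ
  sumVanishing : ℕ
  index : Option ℕ

/-- The scan, for `m` unclustered points. One operation for each cluster. -/
def scanBalance {U : Type u} (m : ℕ) : List (Cluster U) → Timed BalanceScan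
  | [] => ret ⟨0, 0, none⟩
  | D :: Ds =>
    step 1 <| (scanBalance m Ds).map fun r =>
      { sumPersistent := D.numPersistent + r.sumPersistent
        sumVanishing := D.numVanishing + r.sumVanishing
        index :=
          if m + (D.numVanishing + r.sumVanishing) < D.numPersistent + r.sumPersistent then some 0
          else r.index.map (fun i => i + 1) }

section Procedures

variable {U : Type u} [MetricSpace U] (L : Lifetimes U) (γ : ℝ) (k : ℕ)

open scoped Classical in
/-- Scan the given clusters in order and put `x` into the first one whose center is at distance at
most `2γ`; `none` if there is no such cluster. One operation for each center examined, one for the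
insertion. -/
noncomputable def place (x : U) : List (Cluster U) → Timed (Option (List (Cluster U)))
  | [] => ret none
  | D :: Ds =>
    step 1 <|
      if dist x D.center ≤ 2 * γ then step 1 (ret (some (D.push L x :: Ds)))
      else (place x Ds).map (Option.map (fun Es => D :: Es))

open scoped Classical in
/-- Scan a list, move the points at distance at most `2γ` from the center of `D` into `D`, and keep
the others. The center itself, which already belongs to `D`, is dropped from the list. -/
noncomputable def gather (D : Cluster U) : List U → Timed (Cluster U × List U)
  | [] => ret (D, [])
  | x :: xs =>
    step 1 <|
      if x = D.center then gather D xs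
      else if dist x D.center ≤ 2 * γ then step 1 (gather (D.push L x) xs)
      else (gather D xs).map (fun r => (r.1, x :: r.2))

/-- Make the point of the list `x :: xs` that is deleted last the center of a new cluster, and move
into that cluster all points of the list at distance at most `2γ` from it. -/
noncomputable def carve (x : U) (xs : List U) : Timed (Cluster U × List U) :=
  (pickLast L x xs).bind fun u => step 1 (gather L γ (Cluster.single u) (x :: xs))

/-- Create up to `m` clusters one after the other from the points of the list; return them with the
points left over. -/
noncomputable def rebuild : ℕ → List U → Timed (List (Cluster U) × List U)
  | 0, R => step 1 (ret ([], R))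
  | _ + 1, [] => step 1 (ret ([], []))
  | m + 1, x :: xs =>
    step 1 <| (carve L γ x xs).bind fun r =>
      (rebuild m r.2).map fun s => (r.1 :: s.1, s.2)

/-- The procedure `Reclustering(γ)`. -/
noncomputable def recluster (s : Clustering U) : Timed (Clustering U) :=
  step 1 <| (scanBalance s.unclustered.length s.clusters).bind fun b =>
    match b.index with
    | none => ret s
    | some i =>
      let R := s.unclustered ++ (s.clusters.drop i).flatMap Cluster.members
      step (R.length + (s.clusters.drop i).length) <|
        (rebuild L γ (k - i) R).map fun r => ⟨s.clusters.take i ++ r.1, r.2⟩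

/-- The procedure `Insert(p, γ)` up to its final call of `Reclustering(γ)`. -/
noncomputable def insertCore (p : U) (s : Clustering U) : Timed (Clustering U) :=
  step 1 <| (place L γ p s.clusters).bind fun r =>
    match r with
    | some Ds => ret ⟨Ds, s.unclustered⟩
    | none =>
      step 1 <|
        if s.clusters.length < k then ret ⟨s.clusters ++ [Cluster.single p], s.unclustered⟩
        else ret ⟨s.clusters, p :: s.unclustered⟩

open scoped Classical in
/-- Scan the centers for `p`. If `p = c_i`, return the clusters before `D_i`, the cluster `D_i`, and
the clusters after `D_i`. -/
noncomputable def findCenter (p : U) :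
    List (Cluster U) → Timed (Option (List (Cluster U) × Cluster U × List (Cluster U)))
  | [] => ret none
  | D :: Ds =>
    step 1 <|
      if p = D.center then ret (some ([], D, Ds))
      else (findCenter p Ds).map (Option.map fun r => (D :: r.1, r.2.1, r.2.2))

open scoped Classical in
/-- The loop that distributes the points `x ≠ p` of the cluster `D_i` of the deleted center `p`,
where `b = i` is the number of clusters of index at most `i`, and `after`, `un` are the current
clusters of index larger than `i` and the current unclustered points. -/
noncomputable def reassign (p : U) (b : ℕ) :
    List U → List (Cluster U) → List U → Timed (List (Cluster U) × List U)
  | [], after, un => ret (after, un)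
  | x :: xs, after, un =>
    step 1 <|
      if x = p then reassign p b xs after un
      else (place L γ x after).bind fun r =>
        match r with
        | some after' => reassign p b xs after' un
        | none =>
          step 1 <|
            if b + after.length < k then reassign p b xs (after ++ [Cluster.single x]) un
            else reassign p b xs after (x :: un)

/-- If there are unclustered points, the one deleted last becomes the center of a new cluster. -/
noncomputable def promote (s : Clustering U) : Timed (Clustering U) :=
  step 1 <|
    match s.unclustered with
    | [] => ret s
    | x :: xs => (carve L γ x xs).map fun r => ⟨s.clusters ++ [r.1], r.2⟩

open scoped Classical in
/-- The procedure `Delete(p, γ)` up to its final call of `Reclustering(γ)`. A point that is not a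
center is unlinked from its doubly linked list, and the counter of its cluster updated, in a
constant number of operations, by means of the pointers kept with its entry in the queue. -/
noncomputable def deleteCore (p : U) (s : Clustering U) : Timed (Clustering U) :=
  step 1 <| (findCenter p s.clusters).bind fun r =>
    match r with
    | none =>
      step 2 (ret ⟨s.clusters.map (Cluster.unlink L p), s.unclustered.filter (fun x => x ≠ p)⟩)
    | some (before, D, after) =>
      (reassign L γ k p (before.length + 1) D.members after s.unclustered).bind fun q =>
        -- removal of the cluster, and one operation for each cluster that gets a new index
        step (1 + q.1.length) (promote L γ ⟨before ++ q.1, q.2⟩)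

end Procedures

/-! ## All guesses together -/

/-- A guess `γ` (the radius), its data structure, and a record, kept for the analysis only, of the
operations spent so far in all calls of `Insert(·, γ)`, of `Delete(·, γ)` (both including the calls
of `Reclustering(γ)` that they make), and of `Reclustering(γ)`. -/
structure Guess (U : Type u) where
  radius : ℝ
  data : Clustering U
  insertOps : ℕ
  deleteOps : ℕ
  reclusterOps : ℕ

/-- The procedure `Insert(p, γ)`. -/
noncomputable def insertPoint {U : Type u} [MetricSpace U] (L : Lifetimes U) (k : ℕ) (p : U)
    (g : Guess U) : Timed (Guess U) :=
  let a := insertCore L g.radius k p g.data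
  let b := recluster L g.radius k a.val
  ⟨⟨g.radius, b.val, g.insertOps + (a.ops + b.ops), g.deleteOps, g.reclusterOps + b.ops⟩,
    a.ops + b.ops⟩

/-- The procedure `Delete(p, γ)`. -/
noncomputable def deletePoint {U : Type u} [MetricSpace U] (L : Lifetimes U) (k : ℕ) (p : U)
    (g : Guess U) : Timed (Guess U) :=
  let a := deleteCore L g.radius k p g.data
  let b := recluster L g.radius k a.val
  ⟨⟨g.radius, b.val, g.insertOps, g.deleteOps + (a.ops + b.ops), g.reclusterOps + b.ops⟩,
    a.ops + b.ops⟩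

/-- Run a procedure for each guess. -/
def forGuesses {U : Type u} (f : Guess U → Timed (Guess U)) :
    List (Guess U) → Timed (List (Guess U))
  | [] => ret []
  | g :: gs => step 1 <| (f g).bind fun g' => (forGuesses f gs).map fun gs' => g' :: gs'

/-- The memory of the algorithm: the priority queue and the guesses. -/
structure Memory (U : Type u) where
  queue : Heap U
  guesses : List (Guess U)

/-- The loop of `Update` that deletes the points with deletion time at most `t`, the first one in
the queue each time. The first argument bounds the number of iterations. -/
noncomputable def removeExpired {U : Type u} [MetricSpace U] (L : Lifetimes U) (k t : ℕ) :
    ℕ → Memory U → Timed (Memory U)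
  | 0, s => step 1 (ret s)
  | m + 1, s =>
    step 1 <|
      match s.queue with
      | Heap.nil => ret s
      | Heap.node _ q l r =>
        if L.del q ≤ t then
          (Heap.merge L l r).bind fun h =>
            (forGuesses (deletePoint L k q) s.guesses).bind fun gs =>
              removeExpired L k t m ⟨h, gs⟩
        else ret s

/-- A call of `Update(p, t)`; `none` stands for the null point. -/
structure Call (U : Type u) where
  point : Option U
  time : ℕ

/-- The procedure `Update(p, t)`. The loop cannot run more often than there are points in the
queue. -/
noncomputable def update {U : Type u} [MetricSpace U] (L : Lifetimes U) (k : ℕ) (c : Call U)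
    (s : Memory U) : Timed (Memory U) :=
  step 1 <| (removeExpired L k c.time s.queue.size s).bind fun s' =>
    match c.point with
    | none => ret s'
    | some p =>
      (forGuesses (insertPoint L k p) s'.guesses).bind fun gs =>
        (Heap.insert L p s'.queue).map fun h => ⟨h, gs⟩

/-- The set `Γ` of guesses: all `(1 + β) ^ i`, where `β = ε / 2` and the integer `i` runs from
`⌊log_{1 + β} dmin⌋` to `⌈log_{1 + β} dmax⌉`. -/
noncomputable def guessRadii (ε dmin dmax : ℝ) : List ℝ :=
  (List.range (⌈Real.logb (1 + ε / 2) dmax⌉ + 1 - ⌊Real.logb (1 + ε / 2) dmin⌋).toNat).map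
    fun m => (1 + ε / 2) ^ (⌊Real.logb (1 + ε / 2) dmin⌋ + (m : ℤ))

/-- The memory before the first call, when nothing has been inserted. -/
noncomputable def startMemory (U : Type u) (ε dmin dmax : ℝ) : Memory U :=
  ⟨Heap.nil, (guessRadii ε dmin dmax).map fun γ => ⟨γ, ⟨[], []⟩, 0, 0, 0⟩⟩

/-- Execute a sequence of calls of `Update`. -/
noncomputable def runCalls {U : Type u} [MetricSpace U] (L : Lifetimes U) (k : ℕ) :
    List (Call U) → Memory U → Timed (Memory U)
  | [], s => ret s
  | c :: cs, s => (update L k c s).bind (runCalls L k cs)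

/-- The calls that may occur: times do not decrease, a call that inserts a point inserts a point of
the data set at its arrival time, and no point is inserted twice. Calls with the null point may
occur at any time. -/
structure ValidCalls {U : Type u} (X : Set U) (L : Lifetimes U) (calls : List (Call U)) : Prop where
  sorted : (calls.map Call.time).Pairwise (fun s t => s ≤ t)
  arrival : ∀ c ∈ calls, ∀ p, c.point = some p → p ∈ X ∧ c.time = L.arr p
  once : (calls.filterMap Call.point).Nodup

/-- The largest size of an active set at the time of a call. -/
noncomputable def maxActive {U : Type u} (X : Set U) (L : Lifetimes U) (calls : List (Call U)) : ℕ :=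
  (calls.map fun c => (activeSet X L c.time).ncard).foldr max 0

end LifetimeKCenter

open LifetimeKCenter

/-!
The operations are paid for by a potential argument, carried out for each guess separately.

Call a point *settled* if it is unclustered or vanishing. A settled point never becomes persistent
again, and the potential of a persistent point is so large (at least `20 k`) that its conversion
into a settled point pays `O(k)` operations. This covers `Reclustering(γ)` (`recluster_spec`): the
points it handles are less than twice as many as the persistent ones among them, all of which become
settled, and each of the at most `k` clusters carved costs a constant per point. It restores the
balance condition `Balanced`: from each cluster on, there are at most as many persistent points as
settled ones.

The delicate case is the deletion of a center `p` (`deleteCore_spec`). The first point to expire is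
`p`, so the other points of its cluster are persistent. A persistent point that moves from one
cluster to a later one pays for the clusters it passes, since its potential decreases by one per
cluster. What remains is a constant for each reassigned point, for each unclustered point (one
cluster is carved out of these) and for each persistent point of a later cluster, whose index
decreases. By the balance condition the number of all these points is bounded by the number of
settled points after the deleted cluster, up to a constant. Each of them pays, because the potential
of a settled point is six times the number of earlier centers that expire before it, and `p` was
such a center (`potential_cons_pre`). A cluster carved out of the unclustered points does not
increase this number, as its center outlives them all (`promote_spec`).

Thus each insertion or deletion costs `O(k)` amortized operations per guess. The queue is a leftist
heap whose ranks are logarithmic in its size (`Heap.two_pow_rank_le`), and after each call it holds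
active points only, so each of its operations costs `O(1 + log M)`. Finally the number of guesses is
`O(1 + log Δ / ε)`, because `log (1 + ε / 2)` is at least a constant times `ε` for bounded `ε`.
-/

/-! ### Counting operations -/

namespace Timed

variable {α : Type u} {β : Type v}

@[simp] theorem val_ret (a : α) : (ret a).val = a := rfl

@[simp] theorem ops_ret (a : α) : (ret a).ops = 0 := rfl

@[simp] theorem val_bind (x : Timed α) (f : α → Timed β) : (x.bind f).val = (f x.val).val := rfl

@[simp] theorem ops_bind (x : Timed α) (f : α → Timed β) :
    (x.bind f).ops = x.ops + (f x.val).ops := rfl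

@[simp] theorem val_map (f : α → β) (x : Timed α) : (x.map f).val = f x.val := rfl

@[simp] theorem ops_map (f : α → β) (x : Timed α) : (x.map f).ops = x.ops := rfl

@[simp] theorem val_step (c : ℕ) (x : Timed α) : (x.step c).val = x.val := rfl

@[simp] theorem ops_step (c : ℕ) (x : Timed α) : (x.step c).ops = c + x.ops := rfl

end Timed

namespace LifetimeKCenter

open Timed

/-! ### The priority queue -/

namespace Heap

variable {U : Type u}

/-- The points stored in the heap. -/
def points : Heap U → Multiset U
  | nil => 0
  | node _ x l r => x ::ₘ (l.points + r.points)

/-- The stored ranks are the lengths of the right spines, and the rank of a left subtree is at least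
that of its sibling. -/
def Leftist : Heap U → Prop
  | nil => True
  | node n _ l r => n = r.rank + 1 ∧ r.rank ≤ l.rank ∧ l.Leftist ∧ r.Leftist

/-- Heap order: every point expires no later than the points below it. -/
def Ordered (L : Lifetimes U) : Heap U → Prop
  | nil => True
  | node _ x l r => (∀ y ∈ l.points + r.points, L.key x ≤ L.key y) ∧ l.Ordered L ∧ r.Ordered L

theorem card_points (h : Heap U) : h.points.card = h.size := by
  induction h with
  | nil => rfl
  | node n x l r ihl ihr => simp [points, size, ihl, ihr]

theorem two_pow_rank_le {h : Heap U} (hh : h.Leftist) : 2 ^ h.rank ≤ h.size + 1 := by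
  induction h with
  | nil => simp [rank]
  | node n x l r ihl ihr =>
    obtain ⟨rfl, hrl, hl, hr⟩ := hh
    have h1 := ihl hl
    have h2 := ihr hr
    have h3 : 2 ^ r.rank ≤ 2 ^ l.rank := Nat.pow_le_pow_right (by norm_num) hrl
    change 2 ^ (r.rank + 1) ≤ l.size + r.size + 1 + 1
    rw [pow_succ]
    omega

theorem rank_le_log {h : Heap U} {m : ℕ} (hh : h.Leftist) (hm : h.size + 1 ≤ m) :
    h.rank ≤ Nat.log 2 m :=
  Nat.le_log_of_pow_le (by norm_num) ((two_pow_rank_le hh).trans hm)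

@[simp] theorem points_mk (x : U) (a b : Heap U) :
    (mk x a b).points = x ::ₘ (a.points + b.points) := by
  unfold mk
  split <;> simp [points, add_comm]

theorem leftist_mk (x : U) {a b : Heap U} (ha : a.Leftist) (hb : b.Leftist) :
    (mk x a b).Leftist := by
  unfold mk
  split_ifs with h
  · exact ⟨rfl, h, ha, hb⟩
  · exact ⟨rfl, (not_le.1 h).le, hb, ha⟩

theorem ordered_mk (L : Lifetimes U) {x : U} {a b : Heap U} (ha : a.Ordered L) (hb : b.Ordered L)
    (hx : ∀ y ∈ a.points + b.points, L.key x ≤ L.key y) : (mk x a b).Ordered L := by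
  unfold mk
  split_ifs with h
  · exact ⟨hx, ha, hb⟩
  · exact ⟨fun y hy => hx y (by rwa [add_comm]), hb, ha⟩

theorem points_merge (L : Lifetimes U) (a b : Heap U) :
    (merge L a b).val.points = a.points + b.points := by
  induction a, b using merge.induct with
  | case1 h => simp [merge, points]
  | case2 n x l r => simp [merge, points]
  | case3 n x l r n' x' l' r' ih ih' =>
    by_cases h : L.key x ≤ L.key x'
    · rw [merge, if_pos h]
      simp only [val_step, val_map, points_mk, ih, points, ← Multiset.singleton_add]
      abel
    · rw [merge, if_neg h]
      simp only [val_step, val_map, points_mk, ih', points, ← Multiset.singleton_add]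
      abel

theorem leftist_merge (L : Lifetimes U) (a b : Heap U) (ha : a.Leftist) (hb : b.Leftist) :
    (merge L a b).val.Leftist := by
  induction a, b using merge.induct with
  | case1 h => simpa [merge] using hb
  | case2 n x l r => simpa [merge] using ha
  | case3 n x l r n' x' l' r' ih ih' =>
    by_cases h : L.key x ≤ L.key x'
    · rw [merge, if_pos h]
      exact leftist_mk x ha.2.2.1 (ih ha.2.2.2 hb)
    · rw [merge, if_neg h]
      exact leftist_mk x' hb.2.2.1 (ih' ha hb.2.2.2)

theorem ordered_merge (L : Lifetimes U) (a b : Heap U) (ha : a.Ordered L) (hb : b.Ordered L) :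
    (merge L a b).val.Ordered L := by
  induction a, b using merge.induct with
  | case1 h => simpa [merge] using hb
  | case2 n x l r => simpa [merge] using ha
  | case3 n x l r n' x' l' r' ih ih' =>
    by_cases h : L.key x ≤ L.key x'
    · rw [merge, if_pos h]
      refine ordered_mk L ha.2.1 (ih ha.2.2 hb) fun y hy => ?_
      have hx := ha.1 y
      have hx' := hb.1 y
      rw [points_merge] at hy
      simp only [points, Multiset.mem_add, Multiset.mem_cons] at hx hx' hy
      rcases hy with hy | hy | rfl | hy
      · exact hx (.inl hy)
      · exact hx (.inr hy)
      · exact h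
      · exact h.trans (hx' hy)
    · rw [merge, if_neg h]
      refine ordered_mk L hb.2.1 (ih' ha hb.2.2) fun y hy => ?_
      have hx := ha.1 y
      have hx' := hb.1 y
      rw [points_merge] at hy
      simp only [points, Multiset.mem_add, Multiset.mem_cons] at hx hx' hy
      rcases hy with hy | (rfl | hy) | hy
      · exact hx' (.inl hy)
      · exact (not_le.1 h).le
      · exact (not_le.1 h).le.trans (hx hy)
      · exact hx' (.inr hy)

/-- Each visited node shortens one of the two right spines. -/
theorem ops_merge_le (L : Lifetimes U) (a b : Heap U) (ha : a.Leftist) (hb : b.Leftist) :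
    (merge L a b).ops ≤ a.rank + b.rank + 1 := by
  induction a, b using merge.induct with
  | case1 h => simp [merge]
  | case2 n x l r => simp [merge]
  | case3 n x l r n' x' l' r' ih ih' =>
    by_cases h : L.key x ≤ L.key x'
    · rw [merge, if_pos h]
      have := ih ha.2.2.2 hb
      have := ha.1
      simp only [ops_step, ops_map, rank] at *
      omega
    · rw [merge, if_neg h]
      have := ih' ha hb.2.2.2
      have := hb.1
      simp only [ops_step, ops_map, rank] at *
      omega

theorem points_insert (L : Lifetimes U) (x : U) (h : Heap U) :
    (insert L x h).val.points = x ::ₘ h.points := by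
  simp [insert, points_merge, points]

theorem leftist_insert (L : Lifetimes U) (x : U) {h : Heap U} (hh : h.Leftist) :
    (insert L x h).val.Leftist :=
  leftist_merge L _ _ ⟨rfl, le_rfl, trivial, trivial⟩ hh

theorem ordered_insert (L : Lifetimes U) (x : U) {h : Heap U} (hh : h.Ordered L) :
    (insert L x h).val.Ordered L :=
  ordered_merge L _ _ ⟨by simp [points], trivial, trivial⟩ hh

theorem ops_insert_le (L : Lifetimes U) (x : U) {h : Heap U} (hh : h.Leftist) :
    (insert L x h).ops ≤ h.rank + 3 := by
  have := ops_merge_le L (node 1 x nil nil) h ⟨rfl, le_rfl, trivial, trivial⟩ hh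
  simp only [insert, ops_step, rank] at *
  omega

end Heap

/-! ### Clusters -/

section Clusters

variable {U : Type u} (L : Lifetimes U)

/-- The center is a member and the counters are correct. -/
structure Cluster.WellFormed (D : Cluster U) : Prop where
  center_mem : D.center ∈ D.members
  persistent : D.numPersistent = D.members.countP (fun x => L.key D.center < L.key x)
  vanishing : D.numVanishing = D.members.countP (fun x => ¬ L.key D.center < L.key x)

/-- The number of persistent points in the given clusters. -/
def sumPersistent (Ds : List (Cluster U)) : ℕ := (Ds.map Cluster.numPersistent).sum

/-- The number of vanishing points in the given clusters. -/
def sumVanishing (Ds : List (Cluster U)) : ℕ := (Ds.map Cluster.numVanishing).sum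

/-- The points in the given clusters and in the list of unclustered points. -/
def points (Ds : List (Cluster U)) (un : List U) : Multiset U :=
  (un : Multiset U) + (Ds.map fun D => (D.members : Multiset U)).sum

@[simp] theorem sumPersistent_nil : sumPersistent ([] : List (Cluster U)) = 0 := rfl

@[simp] theorem sumPersistent_cons (D : Cluster U) (Ds : List (Cluster U)) :
    sumPersistent (D :: Ds) = D.numPersistent + sumPersistent Ds := by simp [sumPersistent]

@[simp] theorem sumPersistent_append (Ds Es : List (Cluster U)) :
    sumPersistent (Ds ++ Es) = sumPersistent Ds + sumPersistent Es := by simp [sumPersistent]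

@[simp] theorem sumVanishing_nil : sumVanishing ([] : List (Cluster U)) = 0 := rfl

@[simp] theorem sumVanishing_cons (D : Cluster U) (Ds : List (Cluster U)) :
    sumVanishing (D :: Ds) = D.numVanishing + sumVanishing Ds := by simp [sumVanishing]

@[simp] theorem sumVanishing_append (Ds Es : List (Cluster U)) :
    sumVanishing (Ds ++ Es) = sumVanishing Ds + sumVanishing Es := by simp [sumVanishing]

@[simp] theorem points_nil (un : List U) : points [] un = un := by simp [points]

@[simp] theorem points_cons (D : Cluster U) (Ds : List (Cluster U)) (un : List U) :
    points (D :: Ds) un = D.members + points Ds un := by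
  simp only [points, List.map_cons, List.sum_cons]
  abel

theorem points_append (Ds Es : List (Cluster U)) (un : List U) :
    points (Ds ++ Es) un = points Ds [] + points Es un := by
  simp only [points, List.map_append, List.sum_append, Multiset.coe_nil]
  abel

theorem points_cons_right (Ds : List (Cluster U)) (x : U) (un : List U) :
    points Ds (x :: un) = x ::ₘ points Ds un := by
  simp [points, ← Multiset.cons_coe]

theorem coe_append_flatMap_members (Ds : List (Cluster U)) (un : List U) :
    ((un ++ Ds.flatMap Cluster.members : List U) : Multiset U) = points Ds un := by
  induction Ds with
  | nil => simp
  | cons D Ds ih =>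
    rw [points_cons, ← ih, List.flatMap_cons]
    simp only [← Multiset.coe_add]
    abel

variable {L}

theorem Cluster.WellFormed.length_members {D : Cluster U} (h : D.WellFormed L) :
    D.members.length = D.numPersistent + D.numVanishing := by
  rw [h.persistent, h.vanishing,
    List.length_eq_countP_add_countP (fun x => decide (L.key D.center < L.key x))]
  simp

theorem card_points {Ds : List (Cluster U)} (h : ∀ D ∈ Ds, D.WellFormed L) (un : List U) :
    (points Ds un).card = un.length + sumPersistent Ds + sumVanishing Ds := by
  induction Ds with
  | nil => simp
  | cons D Ds ih =>
    rw [List.forall_mem_cons] at h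
    simp only [points_cons, Multiset.card_add, ih h.2, Multiset.coe_card, h.1.length_members,
      sumPersistent_cons, sumVanishing_cons]
    ring

variable (L) in
theorem Cluster.wellFormed_single (u : U) : (Cluster.single u).WellFormed L :=
  ⟨by simp [Cluster.single], by simp [Cluster.single], by simp [Cluster.single]⟩

@[simp] theorem Cluster.center_push (x : U) (D : Cluster U) : (D.push L x).center = D.center := by
  unfold Cluster.push
  split <;> rfl

@[simp] theorem Cluster.members_push (x : U) (D : Cluster U) :
    (D.push L x).members = x :: D.members := by
  unfold Cluster.push
  split <;> rfl

theorem Cluster.WellFormed.push {D : Cluster U} (h : D.WellFormed L) (x : U) :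
    (D.push L x).WellFormed L := by
  refine ⟨by simp [h.center_mem], ?_, ?_⟩
  · simp only [center_push, members_push, List.countP_cons, ← h.persistent]
    by_cases hx : L.key D.center < L.key x <;> simp only [Cluster.push, hx] <;> simp
  · simp only [center_push, members_push, List.countP_cons, ← h.vanishing]
    by_cases hx : L.key D.center < L.key x <;> simp only [Cluster.push, hx] <;> simp

@[simp] theorem Cluster.center_unlink (p : U) (D : Cluster U) :
    (D.unlink L p).center = D.center := by
  unfold Cluster.unlink
  split_ifs <;> rfl

open scoped Classical in
theorem Cluster.members_unlink (p : U) (D : Cluster U) :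
    (D.unlink L p).members = D.members.filter (fun x => x ≠ p) := by
  unfold Cluster.unlink
  split_ifs with h
  · rfl
  · rfl
  · refine (List.filter_eq_self.2 fun x hx => ?_).symm
    simpa using fun hxp : x = p => h (hxp ▸ hx)

open scoped Classical in
/-- Removing a point from a duplicate-free list lowers the count by one if it was counted. -/
theorem countP_filter_ne {l : List U} (hl : l.Nodup) {p : U} (hp : p ∈ l) (f : U → Bool) :
    (l.filter (fun x => x ≠ p)).countP f = l.countP f - if f p then 1 else 0 := by
  have h := (List.perm_cons_erase hp).countP_eq f
  rw [hl.erase_eq_filter, List.countP_cons] at h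
  have h2 : l.filter (fun x => x ≠ p) = l.filter (fun x => x != p) := by
    congr 1
    funext x
    rw [Bool.eq_iff_iff]
    simp
  rw [h2, h]
  split_ifs <;> simp

theorem Cluster.WellFormed.unlink {D : Cluster U} (h : D.WellFormed L) (hn : D.members.Nodup)
    {p : U} (hp : p ≠ D.center) : (D.unlink L p).WellFormed L := by
  refine ⟨?_, ?_, ?_⟩
  · rw [members_unlink]
    simpa [h.center_mem] using hp.symm
  · rw [members_unlink, center_unlink]
    by_cases hm : p ∈ D.members
    · rw [countP_filter_ne hn hm, ← h.persistent]
      by_cases hx : L.key D.center < L.key p <;>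
        simp only [Cluster.unlink, hm, hx] <;> simp
    · rw [Cluster.unlink, if_neg hm, h.persistent, List.filter_eq_self.2]
      intro x hx
      simpa using fun hxp : x = p => hm (hxp ▸ hx)
  · rw [members_unlink, center_unlink]
    by_cases hm : p ∈ D.members
    · rw [countP_filter_ne hn hm, ← h.vanishing]
      by_cases hx : L.key D.center < L.key p <;>
        simp only [Cluster.unlink, hm, hx] <;> simp
    · rw [Cluster.unlink, if_neg hm, h.vanishing, List.filter_eq_self.2]
      intro x hx
      simpa using fun hxp : x = p => hm (hxp ▸ hx)

end Clusters

/-! ### The potential -/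

section Potential

variable {U : Type u} (L : Lifetimes U) (k : ℕ)

/-- The potential of a point that is unclustered or vanishing, where `pre` holds the centers of the
clusters before its own one, or of all clusters: six times the number of these centers that expire
before the point. -/
def settledPotential (pre : Multiset U) (y : U) : ℤ :=
  6 * pre.countP (fun c => L.key c < L.key y)

/-- The potential of a point of a cluster with center `c`, where `pre` holds the centers of the
clusters before that cluster. That of a persistent point is so large that it pays for all that
happens when the point ceases to be persistent; it decreases from each cluster to the next one. -/
def memberPotential (pre : Multiset U) (c y : U) : ℤ :=
  if L.key c < L.key y then 21 * k - pre.card else settledPotential L pre y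

/-- The potential of a list of clusters, where `pre` holds the centers of the clusters before it,
together with the unclustered points. -/
def potential (pre : Multiset U) : List (Cluster U) → List U → ℤ
  | [], un => (un.map (settledPotential L pre)).sum
  | D :: Ds, un =>
    (D.members.map (memberPotential L k pre D.center)).sum + potential (D.center ::ₘ pre) Ds un

variable {L k}

theorem settledPotential_nonneg (pre : Multiset U) (y : U) : 0 ≤ settledPotential L pre y := by
  unfold settledPotential
  positivity

theorem settledPotential_le (pre : Multiset U) (y : U) :
    settledPotential L pre y ≤ 6 * pre.card := by
  unfold settledPotential
  have := Multiset.countP_le_card (fun c => L.key c < L.key y) pre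
  omega

theorem memberPotential_nonneg {pre : Multiset U} (h : pre.card ≤ k) (c y : U) :
    0 ≤ memberPotential L k pre c y := by
  unfold memberPotential
  split_ifs
  · omega
  · exact settledPotential_nonneg _ _

theorem potential_nonneg {pre : Multiset U} {Ds : List (Cluster U)} (h : pre.card + Ds.length ≤ k)
    (un : List U) : 0 ≤ potential L k pre Ds un := by
  induction Ds generalizing pre with
  | nil =>
    refine List.sum_nonneg fun z hz => ?_
    obtain ⟨y, -, rfl⟩ := List.mem_map.1 hz
    exact settledPotential_nonneg _ _
  | cons D Ds ih =>
    rw [List.length_cons] at h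
    refine add_nonneg (List.sum_nonneg fun z hz => ?_) (ih (by simp; omega))
    obtain ⟨y, -, rfl⟩ := List.mem_map.1 hz
    exact memberPotential_nonneg (by omega) _ _

theorem sum_memberPotential_eq (pre : Multiset U) (c : U) (l : List U) :
    (l.map (memberPotential L k pre c)).sum =
      l.countP (fun x => L.key c < L.key x) * (21 * k - pre.card : ℤ) +
        ((l.filter (fun x => ¬ L.key c < L.key x)).map (settledPotential L pre)).sum := by
  induction l with
  | nil => simp
  | cons x l ih =>
    by_cases h : L.key c < L.key x
    · simp only [List.map_cons, List.sum_cons, ih, memberPotential, h, if_true]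
      simp [h]
      ring
    · simp only [List.map_cons, List.sum_cons, ih, memberPotential, h, if_false, List.countP_cons,
        List.filter_cons, decide_false, not_false_eq_true, decide_true, if_true]
      simp only [Bool.false_eq_true, if_false, add_zero]
      ring

theorem sum_settledPotential_nonneg (pre : Multiset U) (l : List U) :
    0 ≤ (l.map (settledPotential L pre)).sum := by
  refine List.sum_nonneg fun z hz => ?_
  obtain ⟨y, -, rfl⟩ := List.mem_map.1 hz
  exact settledPotential_nonneg _ _

theorem sum_settledPotential_le {pre : Multiset U} (h : pre.card ≤ k) (l : List U) :
    (l.map (settledPotential L pre)).sum ≤ 6 * k * l.length := by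
  induction l with
  | nil => simp
  | cons x l ih =>
    have := settledPotential_le (L := L) pre x
    simp only [List.map_cons, List.sum_cons, List.length_cons]
    push_cast
    have h' : (pre.card : ℤ) ≤ k := by exact_mod_cast h
    linarith

theorem le_sum_memberPotential (pre : Multiset U) {D : Cluster U} (hD : D.WellFormed L) :
    D.numPersistent * (21 * k - pre.card : ℤ) ≤
      (D.members.map (memberPotential L k pre D.center)).sum := by
  rw [sum_memberPotential_eq, hD.persistent]
  have := sum_settledPotential_nonneg (L := L) pre
    (D.members.filter (fun x => ¬ L.key D.center < L.key x))
  linarith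

theorem sum_memberPotential_le {pre : Multiset U} (h : pre.card ≤ k) {D : Cluster U}
    (hD : D.WellFormed L) :
    (D.members.map (memberPotential L k pre D.center)).sum ≤
      D.numPersistent * (21 * k - pre.card : ℤ) + 6 * k * D.numVanishing := by
  rw [sum_memberPotential_eq, hD.persistent, hD.vanishing, List.countP_eq_length_filter
    (p := fun x => decide (¬ L.key D.center < L.key x))]
  have := sum_settledPotential_le (L := L) h
    (D.members.filter (fun x => ¬ L.key D.center < L.key x))
  linarith

/-- Persistent points hold a large potential. -/
theorem le_potential {pre : Multiset U} {Ds : List (Cluster U)} (h : pre.card + Ds.length ≤ k)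
    (hD : ∀ D ∈ Ds, D.WellFormed L) (un : List U) :
    20 * k * (sumPersistent Ds : ℤ) ≤ potential L k pre Ds un := by
  induction Ds generalizing pre with
  | nil => simpa [potential] using sum_settledPotential_nonneg pre un
  | cons D Ds ih =>
    rw [List.forall_mem_cons] at hD
    rw [List.length_cons] at h
    have h1 := ih (pre := D.center ::ₘ pre) (by simp; omega) hD.2
    have h2 := le_sum_memberPotential (k := k) pre hD.1
    have h3 : (D.numPersistent : ℤ) * (20 * k) ≤ D.numPersistent * (21 * k - pre.card : ℤ) :=
      mul_le_mul_of_nonneg_left (by omega) (by positivity)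
    simp only [sumPersistent_cons, potential]
    push_cast
    linarith

/-- Without persistent points the potential is moderate. -/
theorem potential_le {pre : Multiset U} {Ds : List (Cluster U)} (h : pre.card + Ds.length ≤ k)
    (hD : ∀ D ∈ Ds, D.WellFormed L) (hP : ∀ D ∈ Ds, D.numPersistent = 0) (un : List U) :
    potential L k pre Ds un ≤ 6 * k * (points Ds un).card := by
  induction Ds generalizing pre with
  | nil => simpa [potential] using sum_settledPotential_le (by simpa using h) un
  | cons D Ds ih =>
    rw [List.forall_mem_cons] at hD hP
    rw [List.length_cons] at h
    have h1 := ih (pre := D.center ::ₘ pre) (by simp; omega) hD.2 hP.2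
    have h2 := sum_memberPotential_le (pre := pre) (k := k) (by omega) hD.1
    have h3 := hD.1.length_members
    simp only [points_cons, potential, Multiset.card_add, Multiset.coe_card, h3]
    rw [hP.1] at h2 ⊢
    push_cast at h2 ⊢
    linarith

theorem potential_append (pre : Multiset U) (Ds Es : List (Cluster U)) (un : List U) :
    potential L k pre (Ds ++ Es) un =
      potential L k pre Ds [] + potential L k ((Ds.map Cluster.center : List U) + pre) Es un := by
  induction Ds generalizing pre with
  | nil => simp [potential]
  | cons D Ds ih =>
    rw [List.cons_append, potential, ih, potential, add_assoc]
    simp [← Multiset.cons_coe]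

/-- When a center expires before all settled points after it, removing it lowers the potential of
each of these points by six, while the persistent points get a smaller index. -/
theorem potential_cons_pre {pre : Multiset U} {c : U} {Ds : List (Cluster U)} {un : List U}
    (hD : ∀ D ∈ Ds, D.WellFormed L) (hc : ∀ y ∈ points Ds un, L.key c < L.key y) :
    potential L k (c ::ₘ pre) Ds un =
      potential L k pre Ds un + 6 * (un.length + sumVanishing Ds : ℤ) - sumPersistent Ds := by
  have settled : ∀ l : List U, (∀ y ∈ l, L.key c < L.key y) → ∀ pre : Multiset U,
      (l.map (settledPotential L (c ::ₘ pre))).sum =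
        (l.map (settledPotential L pre)).sum + 6 * l.length := by
    intro l hl pre
    induction l with
    | nil => simp
    | cons x l ih =>
      rw [List.forall_mem_cons] at hl
      simp only [List.map_cons, List.sum_cons, ih hl.2, settledPotential, List.length_cons,
        Multiset.countP_cons, hl.1, if_true]
      push_cast
      ring
  induction Ds generalizing pre with
  | nil => simpa [potential] using settled un (by simpa using hc) pre
  | cons D Ds ih =>
    rw [List.forall_mem_cons] at hD
    simp only [points_cons, Multiset.mem_add, Multiset.mem_coe] at hc
    have h1 := settled (D.members.filter (fun x => ¬ L.key D.center < L.key x))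
      (fun y hy => hc y (.inl (List.mem_filter.1 hy).1)) pre
    rw [← List.countP_eq_length_filter, ← hD.1.vanishing] at h1
    simp only [potential, sum_memberPotential_eq, ← hD.1.persistent, h1,
      Multiset.cons_swap D.center c, ih hD.2 (fun y hy => hc y (.inr hy)), sumPersistent_cons,
      sumVanishing_cons, Multiset.card_cons]
    push_cast
    ring

theorem potential_cons_right_le {pre : Multiset U} {Ds : List (Cluster U)}
    (h : pre.card + Ds.length ≤ k) (x : U) (un : List U) :
    potential L k pre Ds (x :: un) ≤ potential L k pre Ds un + 6 * k := by
  induction Ds generalizing pre with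
  | nil =>
    have h1 := settledPotential_le (L := L) pre x
    simp only [List.length_nil] at h
    simp only [potential, List.map_cons, List.sum_cons]
    omega
  | cons D Ds ih =>
    rw [List.length_cons] at h
    have := ih (pre := D.center ::ₘ pre) (by simp; omega)
    simp only [potential]
    linarith

theorem potential_append_single_le {pre : Multiset U} {Ds : List (Cluster U)}
    (h : pre.card + Ds.length ≤ k) (x : U) :
    potential L k pre (Ds ++ [Cluster.single x]) [] ≤ potential L k pre Ds [] + 6 * k := by
  rw [potential_append]
  have h1 := settledPotential_le (L := L) ((Ds.map Cluster.center : List U) + pre) x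
  simp only [Multiset.card_add, Multiset.coe_card, List.length_map] at h1
  simp only [potential, Cluster.single, List.map_cons, List.map_nil, List.sum_cons, List.sum_nil,
    memberPotential, lt_irrefl, if_false]
  omega

end Potential

/-! ### Carving clusters -/

section Carving

variable {U : Type u} (L : Lifetimes U)

open scoped Classical in
theorem coe_filter_ne {l : List U} (hn : l.Nodup) (p : U) :
    ((l.filter (fun x => x ≠ p) : List U) : Multiset U) = (l : Multiset U).erase p := by
  rw [Multiset.Nodup.erase_eq_filter p (Multiset.coe_nodup.2 hn), Multiset.filter_coe]

theorem pickLast_spec (best : U) (xs : List U) :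
    (pickLast L best xs).val ∈ best :: xs ∧
      (∀ y ∈ best :: xs, L.key y ≤ L.key (pickLast L best xs).val) ∧
      (pickLast L best xs).ops = xs.length := by
  induction xs generalizing best with
  | nil => simp [pickLast]
  | cons x xs ih =>
    obtain ⟨h1, h2, h3⟩ := ih (if L.key best < L.key x then x else best)
    simp only [pickLast, val_step, ops_step, h3, List.length_cons]
    rw [List.forall_mem_cons] at h2
    refine ⟨?_, ?_, by omega⟩
    · rw [List.mem_cons] at h1
      rcases h1 with h1 | h1
      · rw [h1]
        split_ifs <;> simp
      · exact List.mem_cons_of_mem _ (List.mem_cons_of_mem _ h1)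
    · rw [List.forall_mem_cons, List.forall_mem_cons]
      obtain ⟨h2, h4⟩ := h2
      split_ifs at h2 h4 ⊢ with hb
      · exact ⟨hb.le.trans h2, h2, h4⟩
      · exact ⟨h2, (not_lt.1 hb).trans h2, h4⟩

variable [MetricSpace U] (γ : ℝ)

open scoped Classical in
/-- The center expires last, so only vanishing points are gathered. -/
theorem gather_spec {D : Cluster U} (hD : D.WellFormed L) {xs : List U}
    (hmax : ∀ x ∈ xs, L.key x ≤ L.key D.center) :
    (gather L γ D xs).val.1.center = D.center ∧
      (gather L γ D xs).val.1.WellFormed L ∧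
      (gather L γ D xs).val.1.numPersistent = D.numPersistent ∧
      ((gather L γ D xs).val.1.members + (gather L γ D xs).val.2 : Multiset U) =
        D.members + (xs.filter (fun x => x ≠ D.center) : List U) ∧
      (gather L γ D xs).ops ≤ 2 * xs.length := by
  induction xs generalizing D with
  | nil => simp [gather, hD]
  | cons x xs ih =>
    rw [List.forall_mem_cons] at hmax
    rw [gather]
    split_ifs with h1 h2
    · obtain ⟨a, b, c, d, e⟩ := ih hD hmax.2
      refine ⟨a, b, c, ?_, ?_⟩
      · simpa [h1] using d
      · simp only [ops_step, List.length_cons]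
        omega
    · obtain ⟨a, b, c, d, e⟩ := ih (hD.push x) (by simpa using hmax.2)
      refine ⟨by simpa using a, b, c.trans ?_, ?_, ?_⟩
      · simp [Cluster.push, not_lt.2 hmax.1]
      · simpa [h1, ← Multiset.cons_coe] using d
      · simp only [ops_step, List.length_cons]
        omega
    · obtain ⟨a, b, c, d, e⟩ := ih hD hmax.2
      refine ⟨a, b, c, ?_, ?_⟩
      · simp only [ne_eq, decide_not] at d
        simp [h1, ← Multiset.cons_coe, d]
      · simp only [ops_step, ops_map, List.length_cons]
        omega

theorem carve_spec (x : U) (xs : List U) (hn : (x :: xs).Nodup) :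
    (carve L γ x xs).val.1.WellFormed L ∧
      (carve L γ x xs).val.1.numPersistent = 0 ∧
      (∀ y ∈ x :: xs, L.key y ≤ L.key (carve L γ x xs).val.1.center) ∧
      ((carve L γ x xs).val.1.members + (carve L γ x xs).val.2 : Multiset U) =
        ((x :: xs : List U) : Multiset U) ∧
      (carve L γ x xs).ops ≤ 3 * (x :: xs).length := by
  classical
  obtain ⟨h1, h2, h3⟩ := pickLast_spec L x xs
  obtain ⟨a, b, c, d, e⟩ :=
    gather_spec L γ (Cluster.wellFormed_single L (pickLast L x xs).val) (xs := x :: xs) h2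
  refine ⟨b, c, fun y hy => ?_, ?_, ?_⟩
  · exact (h2 y hy).trans_eq (congrArg L.key a.symm)
  · refine d.trans ((congrArg (_ + ·) (coe_filter_ne hn _)).trans ?_)
    simp only [Cluster.single, Multiset.coe_singleton, Multiset.singleton_add]
    exact Multiset.cons_erase h1
  · simp only [carve, ops_bind, ops_step, h3, List.length_cons] at e ⊢
    omega

theorem rebuild_spec (m : ℕ) (R : List U) (hn : R.Nodup) :
    (∀ D ∈ (rebuild L γ m R).val.1, D.WellFormed L ∧ D.numPersistent = 0) ∧
      points (rebuild L γ m R).val.1 (rebuild L γ m R).val.2 = R ∧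
      (rebuild L γ m R).val.1.length ≤ m ∧
      ((rebuild L γ m R).val.2 ≠ [] → (rebuild L γ m R).val.1.length = m) ∧
      (rebuild L γ m R).ops ≤ 1 + m * (3 * R.length + 1) := by
  induction m generalizing R with
  | zero => simp [rebuild]
  | succ m ih =>
    cases R with
    | nil => simp [rebuild]
    | cons x xs =>
      obtain ⟨a, b, -, d, e⟩ := carve_spec L γ x xs hn
      have hn' : ((carve L γ x xs).val.1.members + (carve L γ x xs).val.2 : Multiset U).Nodup := by
        rw [d]
        exact hn
      obtain ⟨a', b', c', d', e'⟩ := ih (carve L γ x xs).val.2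
        (Multiset.coe_nodup.1 (Multiset.nodup_add.1 hn').2.1)
      simp only [rebuild, val_step, val_bind, val_map, List.forall_mem_cons, points_cons, b', d,
        List.length_cons, ops_step, ops_bind, ops_map]
      refine ⟨⟨⟨a, b⟩, a'⟩, trivial, by omega, fun h => by rw [d' h], ?_⟩
      have hlen : (carve L γ x xs).val.2.length ≤ xs.length + 1 := by
        have := congrArg Multiset.card d
        simp only [Multiset.card_add, Multiset.coe_card, List.length_cons] at this
        omega
      have hmul : m * (3 * (carve L γ x xs).val.2.length + 1) ≤ m * (3 * (xs.length + 1) + 1) :=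
        Nat.mul_le_mul_left _ (by omega)
      rw [List.length_cons] at e
      linarith

end Carving

/-! ### Reclustering -/

section Recluster

variable {U : Type u} (L : Lifetimes U) (k : ℕ)

/-- What holds for the data structure of one guess between any two procedure calls. -/
structure Clustering.Valid (s : Clustering U) : Prop where
  wellFormed : ∀ D ∈ s.clusters, D.WellFormed L
  length_le : s.clusters.length ≤ k
  full : s.unclustered ≠ [] → s.clusters.length = k
  nodup : (points s.clusters s.unclustered).Nodup

/-- The property restored by `Reclustering(γ)`: from each cluster on, there are at most as many
persistent points as there are vanishing points and, elsewhere, `m` unclustered ones. -/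
def Balanced (m : ℕ) (Ds : List (Cluster U)) : Prop :=
  ∀ Bs Es, Ds = Bs ++ Es → sumPersistent Es ≤ m + sumVanishing Es

/-- All points of the data structure. -/
def Clustering.points (s : Clustering U) : Multiset U :=
  LifetimeKCenter.points s.clusters s.unclustered

/-- The potential of the data structure of one guess. -/
def Clustering.potential (s : Clustering U) : ℤ :=
  LifetimeKCenter.potential L k 0 s.clusters s.unclustered

variable {L k}

theorem Clustering.Valid.potential_nonneg {s : Clustering U} (h : s.Valid L k) :
    0 ≤ s.potential L k :=
  LifetimeKCenter.potential_nonneg (by simpa using h.length_le) _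

theorem scanBalance_sums (m : ℕ) (Ds : List (Cluster U)) :
    (scanBalance m Ds).val.sumPersistent = sumPersistent Ds ∧
      (scanBalance m Ds).val.sumVanishing = sumVanishing Ds ∧
      (scanBalance m Ds).ops = Ds.length := by
  induction Ds with
  | nil => simp [scanBalance]
  | cons D Ds ih =>
    obtain ⟨h1, h2, h3⟩ := ih
    simp [scanBalance, h1, h2, h3]
    omega

theorem scanBalance_none (m : ℕ) (Ds : List (Cluster U))
    (h : (scanBalance m Ds).val.index = none) : Balanced m Ds := by
  induction Ds with
  | nil =>
    intro Bs Es hE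
    rw [List.nil_eq, List.append_eq_nil_iff] at hE
    simp [hE.2]
  | cons D Ds ih =>
    obtain ⟨h1, h2, -⟩ := scanBalance_sums m Ds
    simp only [scanBalance, val_step, val_map, h1, h2] at h
    split_ifs at h with hlt
    intro Bs Es hE
    rcases List.cons_eq_append_iff.1 hE with ⟨-, rfl⟩ | ⟨Bs', -, hE'⟩
    · simpa using hlt
    · exact ih (by simpa using h) Bs' Es hE'

/-- The balance condition is violated from the index found on, and from no earlier index. -/
theorem scanBalance_some (m : ℕ) (Ds : List (Cluster U)) (i : ℕ)
    (h : (scanBalance m Ds).val.index = some i) :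
    i < Ds.length ∧ m + sumVanishing (Ds.drop i) < sumPersistent (Ds.drop i) ∧
      ∀ Bs Es, Ds.take i = Bs ++ Es → Es ≠ [] →
        sumPersistent (Es ++ Ds.drop i) ≤ m + sumVanishing (Es ++ Ds.drop i) := by
  induction Ds generalizing i with
  | nil => simp [scanBalance] at h
  | cons D Ds ih =>
    obtain ⟨h1, h2, -⟩ := scanBalance_sums m Ds
    simp only [scanBalance, val_step, val_map, h1, h2] at h
    split_ifs at h with hlt
    · obtain rfl : 0 = i := by simpa using h
      refine ⟨by simp, by simpa using hlt, fun Bs Es hE hne => ?_⟩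
      simp [hne] at hE
    · obtain ⟨j, hj, rfl⟩ := Option.map_eq_some_iff.1 h
      obtain ⟨h3, h4, h5⟩ := ih j hj
      refine ⟨by simpa using h3, by simpa using h4, fun Bs Es hE hne => ?_⟩
      rw [List.take_succ_cons] at hE
      rw [List.drop_succ_cons]
      rcases List.cons_eq_append_iff.1 hE with ⟨-, rfl⟩ | ⟨Bs', -, hE'⟩
      · rw [List.cons_append, List.take_append_drop]
        simpa using hlt
      · exact h5 Bs' Es hE' hne

variable [MetricSpace U] (γ : ℝ)

/-- The points that `Reclustering(γ)` handles are less than twice as many as the persistent ones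
among them, and the latter pay for it when they cease to be persistent. -/
theorem recluster_spec (hk : 1 ≤ k) {s : Clustering U} (hs : s.Valid L k) :
    (recluster L γ k s).val.Valid L k ∧
      Balanced (recluster L γ k s).val.unclustered.length (recluster L γ k s).val.clusters ∧
      (recluster L γ k s).val.points = s.points ∧
      (recluster L γ k s).ops + (recluster L γ k s).val.potential L k ≤
        s.potential L k + 3 * k := by
  obtain ⟨-, -, hops⟩ := scanBalance_sums s.unclustered.length s.clusters
  have hlen := hs.length_le
  rcases hi : (scanBalance s.unclustered.length s.clusters).val.index with _ | i
  · have hval : (recluster L γ k s).val = s := by simp [recluster, hi]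
    have hops' : (recluster L γ k s).ops = 1 + s.clusters.length := by simp [recluster, hi, hops]
    rw [hval, hops']
    refine ⟨hs, scanBalance_none _ _ hi, rfl, ?_⟩
    push_cast
    omega
  · obtain ⟨h1, h2, h3⟩ := scanBalance_some _ _ _ hi
    set Bs := s.clusters.take i with hBs
    set Es := s.clusters.drop i with hEs
    have hsplit : s.clusters = Bs ++ Es := (List.take_append_drop i s.clusters).symm
    have hBlen : Bs.length = i := by simp [hBs, h1.le]
    have hElen : i + Es.length ≤ k := by
      rw [hsplit, List.length_append, hBlen] at hlen
      exact hlen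
    have hwf := hs.wellFormed
    rw [hsplit, List.forall_mem_append] at hwf
    set R := s.unclustered ++ Es.flatMap Cluster.members with hR
    have hRp : (R : Multiset U) = points Es s.unclustered := coe_append_flatMap_members _ _
    have hsp : s.points = points Bs [] + R := by
      rw [Clustering.points, hsplit, points_append, hRp]
    have hnodup : (points Bs [] + R).Nodup := hsp ▸ hs.nodup
    have hRn : R.Nodup := (Multiset.nodup_add.1 hnodup).2.1
    obtain ⟨a, b, c, d, e⟩ := rebuild_spec L γ (k - i) R hRn
    have hval : (recluster L γ k s).val =
        ⟨Bs ++ (rebuild L γ (k - i) R).val.1, (rebuild L γ (k - i) R).val.2⟩ := by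
      simp [recluster, hi, hR, hBs, hEs]
    have hops' : (recluster L γ k s).ops =
        1 + (s.clusters.length + (R.length + Es.length + (rebuild L γ (k - i) R).ops)) := by
      simp [recluster, hi, hops, hR, hEs]
    rw [hval, hops']
    set Ns := (rebuild L γ (k - i) R).val.1
    set un := (rebuild L γ (k - i) R).val.2
    have hNwf : ∀ D ∈ Ns, D.WellFormed L := fun D hD => (a D hD).1
    have hNP : ∀ D ∈ Ns, D.numPersistent = 0 := fun D hD => (a D hD).2
    have hNsum : ∀ l : List (Cluster U), (∀ D ∈ l, D.numPersistent = 0) → sumPersistent l = 0 :=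
      fun l hl => List.sum_eq_zero (by simpa using hl)
    have hpts : points (Bs ++ Ns) un = s.points := by rw [points_append, b, hsp]
    have hRcard : R.length = s.unclustered.length + sumPersistent Es + sumVanishing Es := by
      rw [← card_points hwf.2, ← hRp, Multiset.coe_card]
    have hRcard' : R.length = un.length + sumVanishing Ns := by
      have h := card_points hNwf un
      rw [b, hNsum Ns hNP, Multiset.coe_card] at h
      omega
    refine ⟨⟨?_, ?_, fun hne => ?_, ?_⟩, ?_, hpts, ?_⟩
    · exact List.forall_mem_append.2 ⟨hwf.1, hNwf⟩
    · rw [List.length_append]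
      omega
    · rw [List.length_append, d hne]
      omega
    · rw [hpts]
      exact hs.nodup
    -- none of the new clusters has persistent points, and for earlier ones the index was minimal
    · intro Bs' Es' hE
      rcases List.append_eq_append_iff.1 hE with ⟨l, -, hl⟩ | ⟨l, hl, rfl⟩
      · rw [hNsum Es' fun D hD => hNP D (by rw [hl]; simp [hD])]
        omega
      · rcases eq_or_ne l [] with rfl | hne
        · simp [hNsum Ns hNP]
        · have := h3 Bs' l hl hne
          simp only [sumPersistent_append, sumVanishing_append, hNsum Ns hNP] at this ⊢
          omega
    · have hnew := potential_le (L := L) (k := k) (pre := (Bs.map Cluster.center : List U) + 0)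
        (Ds := Ns) (by simp; omega) hNwf hNP un
      have hold := le_potential (L := L) (k := k) (pre := (Bs.map Cluster.center : List U) + 0)
        (Ds := Es) (by simp; omega) hwf.2 s.unclustered
      simp only [Clustering.potential]
      rw [potential_append, hsplit, potential_append, List.length_append, hBlen]
      rw [b, Multiset.coe_card] at hnew
      have hki : (k - i) * (3 * R.length + 1) ≤ k * (3 * R.length + 1) :=
        Nat.mul_le_mul_right _ (by omega)
      have hRle : R.length + 1 ≤ 2 * sumPersistent Es := by omega
      have hkR : k * (R.length + 1) ≤ k * (2 * sumPersistent Es) := Nat.mul_le_mul_left _ hRle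
      have hR1 : R.length ≤ k * R.length := Nat.le_mul_of_pos_left _ hk
      zify at e hki hkR hR1 hElen hk ⊢
      nlinarith

end Recluster

/-! ### Insertion -/

section Insertion

variable {U : Type u} [MetricSpace U] (L : Lifetimes U) (γ : ℝ) {k : ℕ}

theorem ops_place_of_none {x : U} {Ds : List (Cluster U)} (h : (place L γ x Ds).val = none) :
    (place L γ x Ds).ops = Ds.length := by
  induction Ds with
  | nil => simp [place]
  | cons D Ds ih =>
    rw [place] at h ⊢
    split_ifs at h ⊢ with hd
    · simp at h
    · simp only [val_step, val_map, Option.map_eq_none_iff] at h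
      simp only [ops_step, ops_map, ih h, List.length_cons]
      omega

/-- Each cluster passed over while `x` is placed lowers the potential of a persistent `x` by one. -/
theorem place_spec {x : U} {Ds Es : List (Cluster U)} (h : (place L γ x Ds).val = some Es)
    (hD : ∀ D ∈ Ds, D.WellFormed L) {pre : Multiset U} (hlen : pre.card + Ds.length ≤ k)
    (un : List U) :
    (∀ D ∈ Es, D.WellFormed L) ∧ Es.length = Ds.length ∧ points Es un = x ::ₘ points Ds un ∧
      (place L γ x Ds).ops + potential L k pre Es un ≤
        potential L k pre Ds un + (21 * k - pre.card) + 2 := by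
  induction Ds generalizing Es pre with
  | nil => simp [place] at h
  | cons D Ds ih =>
    rw [List.forall_mem_cons] at hD
    rw [List.length_cons] at hlen
    rw [place] at h ⊢
    split_ifs at h ⊢ with hd
    · obtain rfl : D.push L x :: Ds = Es := by simpa using h
      refine ⟨List.forall_mem_cons.2 ⟨hD.1.push x, hD.2⟩, by simp, ?_, ?_⟩
      · simp [← Multiset.cons_coe]
      · have h1 : memberPotential L k pre D.center x ≤ 21 * k - pre.card := by
          have := settledPotential_le (L := L) pre x
          unfold memberPotential
          split_ifs <;> omega
        simp only [potential, Cluster.center_push, Cluster.members_push, List.map_cons,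
          List.sum_cons, ops_step, ops_ret]
        push_cast
        linarith
    · simp only [val_step, val_map, Option.map_eq_some_iff] at h
      obtain ⟨Fs, hF, rfl⟩ := h
      obtain ⟨h1, h2, h3, h4⟩ := ih hF hD.2 (pre := D.center ::ₘ pre) (by simp; omega)
      refine ⟨List.forall_mem_cons.2 ⟨hD.1, h1⟩, by simp [h2], by simp [h3], ?_⟩
      simp only [potential, ops_step, ops_map, Multiset.card_cons] at h4 ⊢
      push_cast at h4 ⊢
      linarith

theorem insertCore_spec (hk : 1 ≤ k) {p : U} {s : Clustering U} (hs : s.Valid L k)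
    (hp : p ∉ s.points) :
    (insertCore L γ k p s).val.Valid L k ∧
      (insertCore L γ k p s).val.points = p ::ₘ s.points ∧
      (insertCore L γ k p s).ops + (insertCore L γ k p s).val.potential L k ≤
        s.potential L k + 24 * k := by
  obtain ⟨hwf, hlen, hfull, hnodup⟩ := hs
  have hn' : (p ::ₘ points s.clusters s.unclustered).Nodup := Multiset.nodup_cons.2 ⟨hp, hnodup⟩
  simp only [insertCore, val_step, val_bind, ops_step, ops_bind]
  rcases hpl : (place L γ p s.clusters).val with _ | Es
  · have hops := ops_place_of_none L γ hpl
    simp only [val_step, ops_step, hops]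
    split_ifs with hlt
    · have hun : s.unclustered = [] := by
        by_contra h
        exact hlt.ne (hfull h)
      have hpts : points (s.clusters ++ [Cluster.single p]) s.unclustered = p ::ₘ s.points := by
        rw [points_append, Clustering.points, hun]
        simp [Cluster.single, add_comm _ ({p} : Multiset U)]
      refine ⟨⟨?_, ?_, fun h => absurd hun h, hpts ▸ hn'⟩, hpts, ?_⟩
      · simpa [List.forall_mem_append] using
          fun D hD => hD.elim (hwf D) fun h => h ▸ Cluster.wellFormed_single L p
      · simp only [val_ret, List.length_append, List.length_cons, List.length_nil]
        omega
      · have := potential_append_single_le (L := L) (k := k) (pre := 0) (Ds := s.clusters)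
          (by simpa using hlen) p
        simp only [val_ret, ops_ret, Clustering.potential, hun]
        push_cast
        omega
    · refine ⟨⟨hwf, hlen, fun _ => ?_, ?_⟩, points_cons_right _ _ _, ?_⟩
      · exact le_antisymm hlen (not_lt.1 hlt)
      · simpa only [val_ret, points_cons_right] using hn'
      · have := potential_cons_right_le (L := L) (k := k) (pre := 0) (Ds := s.clusters)
          (by simpa using hlen) p s.unclustered
        simp only [val_ret, ops_ret, Clustering.potential]
        push_cast
        omega
  · obtain ⟨h1, h2, h3, h4⟩ := place_spec L γ hpl hwf (k := k) (pre := 0) (by simpa using hlen)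
      s.unclustered
    refine ⟨⟨h1, h2.trans_le hlen, fun h => h2.trans (hfull h), ?_⟩, h3, ?_⟩
    · simpa only [val_ret, h3] using hn'
    · simp only [val_ret, ops_ret, Clustering.potential, Multiset.card_zero] at h4 ⊢
      push_cast at h4 ⊢
      omega

end Insertion

/-! ### Deletion -/

section Deletion

variable {U : Type u}

theorem findCenter_none {p : U} {Ds : List (Cluster U)} (h : (findCenter p Ds).val = none) :
    ∀ D ∈ Ds, p ≠ D.center := by
  induction Ds with
  | nil => simp
  | cons D Ds ih =>
    rw [findCenter] at h
    split_ifs at h with hp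
    · simp at h
    · simp only [val_step, val_map, Option.map_eq_none_iff] at h
      exact List.forall_mem_cons.2 ⟨hp, ih h⟩

theorem findCenter_some {p : U} {Ds : List (Cluster U)}
    {r : List (Cluster U) × Cluster U × List (Cluster U)}
    (h : (findCenter p Ds).val = some r) : Ds = r.1 ++ r.2.1 :: r.2.2 ∧ p = r.2.1.center := by
  induction Ds generalizing r with
  | nil => simp [findCenter] at h
  | cons D Ds ih =>
    rw [findCenter] at h
    split_ifs at h with hp
    · simp only [val_step, val_ret, Option.some.injEq] at h
      subst h
      exact ⟨rfl, hp⟩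
    · simp only [val_step, val_map, Option.map_eq_some_iff] at h
      obtain ⟨q, hq, rfl⟩ := h
      obtain ⟨h1, h2⟩ := ih hq
      exact ⟨by rw [h1]; rfl, h2⟩

theorem ops_findCenter_le (p : U) (Ds : List (Cluster U)) :
    (findCenter p Ds).ops ≤ Ds.length := by
  induction Ds with
  | nil => simp [findCenter]
  | cons D Ds ih =>
    rw [findCenter]
    split_ifs
    · simp
    · simp only [ops_step, ops_map, List.length_cons]
      omega

variable (L : Lifetimes U) {k : ℕ}

open scoped Classical in
theorem points_unlink (p : U) (Ds : List (Cluster U)) (un : List U) :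
    points (Ds.map (Cluster.unlink L p)) (un.filter (fun x => x ≠ p)) =
      (points Ds un).filter (fun x => x ≠ p) := by
  induction Ds with
  | nil => simp
  | cons D Ds ih =>
    rw [List.map_cons, points_cons, points_cons, ih, Multiset.filter_add, Cluster.members_unlink,
      Multiset.filter_coe]

open scoped Classical in
theorem potential_unlink_le (p : U) {pre : Multiset U} {Ds : List (Cluster U)}
    (hlen : pre.card + Ds.length ≤ k) (un : List U) :
    potential L k pre (Ds.map (Cluster.unlink L p)) (un.filter (fun x => x ≠ p)) ≤
      potential L k pre Ds un := by
  induction Ds generalizing pre with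
  | nil =>
    refine (List.filter_sublist.map _).sum_le_sum fun z hz => ?_
    obtain ⟨y, -, rfl⟩ := List.mem_map.1 hz
    exact settledPotential_nonneg _ _
  | cons D Ds ih =>
    rw [List.length_cons] at hlen
    simp only [List.map_cons, potential, Cluster.center_unlink, Cluster.members_unlink]
    refine add_le_add ((List.filter_sublist.map _).sum_le_sum fun z hz => ?_)
      (ih (by simp; omega))
    obtain ⟨y, -, rfl⟩ := List.mem_map.1 hz
    exact memberPotential_nonneg (by omega) _ _

variable [MetricSpace U] (γ : ℝ)

open scoped Classical in
/-- The bound in the last clause makes each unclustered point pay three operations in advance, for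
carving a cluster out of the unclustered points. -/
theorem reassign_spec (p : U) (xs : List U) {after : List (Cluster U)} {un : List U}
    {pre : Multiset U} (hD : ∀ D ∈ after, D.WellFormed L)
    (hlen : pre.card + 1 + after.length ≤ k)
    (hfull : un ≠ [] → pre.card + 1 + after.length = k) :
    let r := reassign L γ k p (pre.card + 1) xs after un
    (∀ D ∈ r.val.1, D.WellFormed L) ∧ pre.card + 1 + r.val.1.length ≤ k ∧
      (r.val.2 ≠ [] → pre.card + 1 + r.val.1.length = k) ∧
      points r.val.1 r.val.2 = points after un + (xs.filter (fun x => x ≠ p) : List U) ∧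
      r.ops + potential L k pre r.val.1 r.val.2 + 3 * r.val.2.length ≤
        potential L k pre after un + 3 * un.length + xs.length +
          (xs.filter (fun x => x ≠ p)).length * (21 * k - pre.card + 2 : ℤ) := by
  intro r
  induction xs generalizing after un with
  | nil => simpa [r, reassign] using ⟨hD, hlen, hfull⟩
  | cons x xs ih =>
    by_cases hx : x = p
    · obtain ⟨a, b, c, d, e⟩ := ih hD hlen hfull
      simp only [r, reassign, hx, if_true, val_step, ops_step]
      refine ⟨a, b, c, by simpa using d, ?_⟩
      simp only [ne_eq, not_true_eq_false, decide_false, Bool.false_eq_true, not_false_eq_true,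
        List.filter_cons_of_neg, List.length_cons] at e ⊢
      push_cast at e ⊢
      linarith
    · have hfil : (x :: xs).filter (fun x => x ≠ p) = x :: xs.filter (fun x => x ≠ p) := by
        simp [hx]
      rw [hfil]
      simp only [r, reassign, hx, if_false, val_step, ops_step, val_bind, ops_bind]
      rcases hpl : (place L γ x after).val with _ | Es
      · have hops := ops_place_of_none L γ hpl
        simp only [val_step, ops_step, hops]
        split_ifs with hlt
        -- no point is unclustered yet, so the new center does not increase any other potential
        · have hun : un = [] := by
            by_contra h
            exact hlt.ne (hfull h)
          subst hun
          obtain ⟨a, b, c, d, e⟩ := ih (after := after ++ [Cluster.single x]) (un := [])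
            (by simpa [List.forall_mem_append] using
              fun D hD' => hD'.elim (hD D) fun h => h ▸ Cluster.wellFormed_single L x)
            (by simp; omega) (by simp)
          have hpot := potential_append_single_le (L := L) (k := k) (pre := pre) (Ds := after)
            (by omega) x
          refine ⟨a, b, c, d.trans ?_, ?_⟩
          · simp only [points_append, points_cons, points_nil, Cluster.single,
              ← Multiset.cons_coe, Multiset.coe_nil,
              ← Multiset.singleton_add]
            abel
          · simp only [List.length_cons, List.length_nil] at e ⊢
            push_cast at e ⊢
            zify at hlen
            linarith
        · obtain ⟨a, b, c, d, e⟩ := ih (after := after) (un := x :: un) hD hlen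
            (fun _ => le_antisymm hlen (not_lt.1 hlt))
          have hpot := potential_cons_right_le (L := L) (k := k) (pre := pre) (Ds := after)
            (by omega) x un
          refine ⟨a, b, c, d.trans ?_, ?_⟩
          · simp only [points_cons_right, ← Multiset.cons_coe, ← Multiset.singleton_add]
            abel
          · simp only [List.length_cons] at e ⊢
            push_cast at e ⊢
            zify at hlen
            linarith
      · obtain ⟨h1, h2, h3, h4⟩ := place_spec L γ hpl hD (k := k) (pre := pre) (by omega) un
        obtain ⟨a, b, c, d, e⟩ := ih (after := Es) (un := un) h1 (by omega)
          (fun h => by rw [h2, hfull h])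
        refine ⟨a, b, c, d.trans ?_, ?_⟩
        · simp only [h3, ← Multiset.cons_coe, ← Multiset.singleton_add]
          abel
        · simp only [List.length_cons] at e ⊢
          push_cast at e ⊢
          linarith

/-- A center that outlives all unclustered points does not change their potential. -/
theorem promote_spec {s : Clustering U} (hwf : ∀ D ∈ s.clusters, D.WellFormed L)
    (hlen : s.clusters.length + 1 ≤ k) (hfull : s.unclustered ≠ [] → s.clusters.length + 1 = k)
    (hnodup : s.points.Nodup) :
    (promote L γ s).val.Valid L k ∧ (promote L γ s).val.points = s.points ∧
      (promote L γ s).val.potential L k = s.potential L k ∧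
      (promote L γ s).ops ≤ 1 + 3 * s.unclustered.length := by
  obtain ⟨cs, un⟩ := s
  cases un with
  | nil => exact ⟨⟨hwf, by simpa [promote] using (Nat.le_succ _).trans hlen, by simp [promote],
      hnodup⟩, rfl, rfl, by simp [promote]⟩
  | cons x xs =>
    have hn : (x :: xs).Nodup := Multiset.coe_nodup.1 (Multiset.nodup_add.1 hnodup).1
    obtain ⟨a, b, c, d, e⟩ := carve_spec L γ x xs hn
    simp only [promote, val_step, val_map, ops_step, ops_map, Clustering.potential,
      Clustering.points]
    set C := (carve L γ x xs).val.1
    set un := (carve L γ x xs).val.2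
    have hpts : points (cs ++ [C]) un = points cs (x :: xs) := by
      rw [points_append, points_cons, points_nil, d]
      simp only [points, Multiset.coe_nil]
      abel
    refine ⟨⟨?_, ?_, fun _ => ?_, ?_⟩, hpts, ?_, by omega⟩
    · simpa [List.forall_mem_append] using
        fun D hD => hD.elim (hwf D) fun h => h ▸ a
    · simpa using hlen
    · simpa using hfull
    · rw [hpts]
      exact hnodup
    · have hmem : ∀ y, y ∈ C.members ∨ y ∈ un → L.key y ≤ L.key C.center := by
        intro y hy
        refine c y ?_
        rw [← Multiset.mem_coe, ← d]
        simpa using hy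
      have h0 := potential_append (L := L) (k := k) 0 cs [] (x :: xs)
      rw [List.append_nil] at h0
      rw [potential_append, h0]
      simp only [potential]
      have h1 : C.members.map (memberPotential L k ((cs.map Cluster.center : List U) + 0) C.center)
          = C.members.map (settledPotential L ((cs.map Cluster.center : List U) + 0)) :=
        List.map_congr_left fun y hy => by
          rw [memberPotential, if_neg (not_lt.2 (hmem y (.inl hy)))]
      have h2 : un.map (settledPotential L (C.center ::ₘ ((cs.map Cluster.center : List U) + 0)))
          = un.map (settledPotential L ((cs.map Cluster.center : List U) + 0)) :=
        List.map_congr_left fun y hy => by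
          rw [settledPotential, Multiset.countP_cons, if_neg (not_lt.2 (hmem y (.inr hy))),
            settledPotential, add_zero]
      have h3 := congrArg (fun m : Multiset U =>
        (m.map (settledPotential L ((cs.map Cluster.center : List U) + 0))).sum) d
      simp only [Multiset.map_add, Multiset.sum_add, Multiset.map_coe, Multiset.sum_coe] at h3
      rw [h1, h2, h3]

/-- When the center `p` of a cluster is the first point to expire, the other points of its cluster
are persistent. The settled points after the cluster lose six units of potential each; by the
balance condition this pays a constant for each point reassigned, for each unclustered point, and
for each persistent point whose index decreases. -/
theorem deleteCore_spec (hk : 1 ≤ k) {p : U} {s : Clustering U} (hs : s.Valid L k)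
    (hb : Balanced s.unclustered.length s.clusters)
    (hmin : ∀ y ∈ s.points, y ≠ p → L.key p < L.key y) :
    (deleteCore L γ k p s).val.Valid L k ∧
      (∀ q, q ∈ (deleteCore L γ k p s).val.points ↔ q ∈ s.points ∧ q ≠ p) ∧
      (deleteCore L γ k p s).ops + (deleteCore L γ k p s).val.potential L k ≤
        s.potential L k + 12 * k := by
  classical
  obtain ⟨hwf, hlen, hfull, hnodup⟩ := hs
  have hfc := ops_findCenter_le p s.clusters
  have hmempts : ∀ D ∈ s.clusters, D.members.Nodup := by
    intro D hD
    have hle : (D.members : Multiset U) ≤ points s.clusters s.unclustered :=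
      (Multiset.single_le_sum (fun _ _ => Multiset.zero_le _) _
        (Multiset.mem_coe.2 (List.mem_map_of_mem hD))).trans (Multiset.le_add_left _ _)
    exact Multiset.coe_nodup.1 (Multiset.nodup_of_le hle hnodup)
  rcases hr : (findCenter p s.clusters).val with _ | ⟨before, D, after⟩
  · have hne := findCenter_none hr
    have hval : (deleteCore L γ k p s).val =
        ⟨s.clusters.map (Cluster.unlink L p), s.unclustered.filter (fun x => x ≠ p)⟩ := by
      simp only [deleteCore, val_step, val_bind, hr, val_ret]
    have hops : (deleteCore L γ k p s).ops = 1 + ((findCenter p s.clusters).ops + 2) := by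
      simp only [deleteCore, ops_step, ops_bind, hr, ops_ret, add_zero]
    rw [hval, hops]
    have hpts := points_unlink L p s.clusters s.unclustered
    refine ⟨⟨?_, by simpa using hlen, fun h => ?_, ?_⟩, fun q => ?_, ?_⟩
    · intro D' hD'
      obtain ⟨D, hD, rfl⟩ := List.mem_map.1 hD'
      exact (hwf D hD).unlink (hmempts D hD) (hne D hD)
    · rw [List.length_map]
      refine hfull fun h' => h ?_
      simp [h']
    · rw [hpts]
      exact hnodup.filter _
    · rw [Clustering.points, hpts, Multiset.mem_filter, Clustering.points]
    · have := potential_unlink_le L (k := k) p (pre := 0) (Ds := s.clusters) (by simpa using hlen)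
        s.unclustered
      simp only [Clustering.potential]
      push_cast
      omega
  · obtain ⟨hsplit, hpD⟩ := findCenter_some hr
    simp only at hsplit hpD
    set pre : Multiset U := (before.map Cluster.center : List U) + 0 with hpre
    have hcard : pre.card = before.length := by simp [hpre]
    have hval : (deleteCore L γ k p s).val = (promote L γ
        ⟨before ++ (reassign L γ k p (before.length + 1) D.members after s.unclustered).val.1,
          (reassign L γ k p (before.length + 1) D.members after s.unclustered).val.2⟩).val := by
      simp only [deleteCore, val_step, val_bind, hr]
    have hops : (deleteCore L γ k p s).ops = 1 + ((findCenter p s.clusters).ops +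
        ((reassign L γ k p (before.length + 1) D.members after s.unclustered).ops +
        (1 + (reassign L γ k p (before.length + 1) D.members after s.unclustered).val.1.length +
        (promote L γ
        ⟨before ++ (reassign L γ k p (before.length + 1) D.members after s.unclustered).val.1,
        (reassign L γ k p (before.length + 1) D.members after s.unclustered).val.2⟩).ops))) := by
      simp only [deleteCore, ops_step, ops_bind, hr]
    rw [hval, hops]
    rw [hsplit] at hwf hlen hfull
    rw [List.forall_mem_append, List.forall_mem_cons] at hwf
    rw [List.length_append, List.length_cons] at hlen hfull
    have hspts : s.points = points before [] + (D.members + points after s.unclustered) := by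
      rw [Clustering.points, hsplit, points_append, points_cons]
    have hnd : (points before [] + (D.members + points after s.unclustered)).Nodup :=
      hspts ▸ hnodup
    have hnd2 := (Multiset.nodup_add.1 hnd).2.1
    have hDn : D.members.Nodup := Multiset.coe_nodup.1 (Multiset.nodup_add.1 hnd2).1
    have hpm : p ∈ D.members := hpD ▸ hwf.2.1.center_mem
    have hmem : ∀ y ∈ D.members, y ≠ p → L.key D.center < L.key y := fun y hy hyp =>
      hpD ▸ hmin y (by rw [hspts]; simp [hy]) hyp
    have hafter : ∀ y ∈ points after s.unclustered, L.key D.center < L.key y := fun y hy =>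
      hpD ▸ hmin y (by rw [hspts]; simp [hy]) fun hyp =>
        Multiset.disjoint_left.1 (Multiset.nodup_add.1 hnd2).2.2
          (Multiset.mem_coe.2 (hyp ▸ hpm : y ∈ D.members)) hy
    -- the points of the cluster, except for its center, are persistent
    have hDP : D.numPersistent = (D.members.filter (fun x => x ≠ p)).length := by
      rw [hwf.2.1.persistent, List.countP_eq_length_filter]
      congr 1
      refine List.filter_congr fun y hy => ?_
      by_cases hyp : y = p
      · simp [hyp, hpD]
      · simp [hyp, hmem y hy hyp]
    have hDlen : D.members.length = D.numPersistent + 1 := by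
      have h := List.length_erase_add_one hpm
      have h2 := congrArg Multiset.card (coe_filter_ne hDn p)
      rw [Multiset.coe_erase, Multiset.coe_card, Multiset.coe_card] at h2
      omega
    have hDV : D.numVanishing = 1 := by
      have := hwf.2.1.length_members
      omega
    obtain ⟨a, b, c, d, e⟩ := reassign_spec L γ (k := k) p D.members (after := after)
      (un := s.unclustered) (pre := pre) hwf.2.2 (by omega) (fun h => by have := hfull h; omega)
    rw [hcard] at a b c d e
    set r := reassign L γ k p (before.length + 1) D.members after s.unclustered
    have hpts : points (before ++ r.val.1) r.val.2 =
        (points before [] + (D.members + points after s.unclustered)).erase p := by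
      rw [points_append, d, coe_filter_ne hDn, Multiset.erase_add_right_pos,
        Multiset.erase_add_left_pos, add_comm (points after _)]
      · exact hpm
      · simp [hpm]
    have hb' := hb before (D :: after) hsplit
    rw [sumPersistent_cons, sumVanishing_cons, hDV] at hb'
    obtain ⟨f1, f2, f3, f4⟩ := promote_spec L γ (k := k) (s := ⟨before ++ r.val.1, r.val.2⟩)
      (List.forall_mem_append.2 ⟨hwf.1, a⟩) (by simp only [List.length_append]; omega)
      (fun h => by simp only [List.length_append]; have := c h; omega)
      (by
        rw [Clustering.points, hpts]
        exact hnd.erase _)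
    refine ⟨f1, fun q => ?_, ?_⟩
    · rw [f2, Clustering.points, hpts, hnd.mem_erase_iff, hspts, and_comm]
    · rw [f3]
      have hold := le_sum_memberPotential (k := k) pre hwf.2.1
      have hdrop := potential_cons_pre (k := k) (pre := pre) hwf.2.2 hafter
      simp only [Clustering.potential]
      rw [hsplit, potential_append, potential_append, potential]
      rw [← hDP, hDlen] at e
      rw [hcard] at hold
      zify at hfc b f4 hb' hk hlen e ⊢
      rw [hsplit] at hfc
      simp only [List.length_append, List.length_cons] at hfc f4
      push_cast at hfc f4 e
      linarith

end Deletion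

/-! ### One guess -/

section Guesses

variable {U : Type u}

theorem Lifetimes.del_le_of_key_le {L : Lifetimes U} {x y : U} (h : L.key x ≤ L.key y) :
    L.del x ≤ L.del y :=
  Prod.Lex.monotone_fst _ _ h

theorem IsDataset.key_lt {X : Set U} {L : Lifetimes U} (hX : IsDataset X L) {x y : U} (hx : x ∈ X)
    (hy : y ∈ X) (hle : L.key x ≤ L.key y) (hne : y ≠ x) : L.key x < L.key y := by
  refine lt_of_le_of_ne hle fun h => hne (hX.arr_injOn hy hx ?_)
  exact (congrArg Prod.snd (toLex_inj.1 h)).symm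

/-- The operations spent for a guess by all insertions and deletions. -/
def Guess.spent (g : Guess U) : ℕ := g.insertOps + g.deleteOps

/-- What holds for a guess after `n` insertions, when `Q` is the set of points in the queue. In the
amortized account, each point pays `54 k` on its arrival; half of this is kept for its deletion. -/
structure Guess.Valid (L : Lifetimes U) (k n : ℕ) (Q : Multiset U) (g : Guess U) : Prop where
  data : g.data.Valid L k
  balanced : Balanced g.data.unclustered.length g.data.clusters
  points_eq : g.data.points = Q
  cost : g.spent + g.data.potential L k + 27 * k * Q.card ≤ 54 * k * n
  reclusterOps_le : g.reclusterOps ≤ g.spent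

theorem Guess.Valid.spent_le {L : Lifetimes U} {k n : ℕ} {Q : Multiset U} {g : Guess U}
    (h : g.Valid L k n Q) : g.spent ≤ 54 * k * n := by
  have h1 := h.cost
  have h2 := h.data.potential_nonneg
  have h3 : (0 : ℤ) ≤ 27 * k * Q.card := by positivity
  zify
  linarith

theorem Guess.Valid.mono {L : Lifetimes U} {k n m : ℕ} {Q : Multiset U} {g : Guess U}
    (h : g.Valid L k n Q) (hnm : n ≤ m) : g.Valid L k m Q := by
  refine ⟨h.data, h.balanced, h.points_eq, h.cost.trans ?_, h.reclusterOps_le⟩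
  exact mul_le_mul_of_nonneg_left (by exact_mod_cast hnm) (by positivity)

variable [MetricSpace U] (L : Lifetimes U) {k : ℕ}

theorem insertPoint_spec (hk : 1 ≤ k) {n : ℕ} {Q : Multiset U} {g : Guess U}
    (hg : g.Valid L k n Q) {p : U} (hp : p ∉ Q) :
    (insertPoint L k p g).val.Valid L k (n + 1) (p ::ₘ Q) := by
  obtain ⟨h1, h2, h3⟩ := insertCore_spec L g.radius hk hg.data (p := p) (by rwa [hg.points_eq])
  obtain ⟨r1, r2, r3, r4⟩ := recluster_spec g.radius hk h1
  refine ⟨r1, r2, ?_, ?_, ?_⟩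
  · rw [← hg.points_eq, ← h2]
    exact r3
  · have := hg.cost
    simp only [insertPoint, Guess.spent, Multiset.card_cons] at *
    push_cast at *
    linarith
  · have := hg.reclusterOps_le
    simp only [insertPoint, Guess.spent] at *
    omega

theorem deletePoint_spec (hk : 1 ≤ k) {n : ℕ} {Q : Multiset U} {g : Guess U} {p : U}
    (hg : g.Valid L k n (p ::ₘ Q)) (hmin : ∀ y ∈ Q, y ≠ p → L.key p < L.key y) :
    (deletePoint L k p g).val.Valid L k n Q := by
  obtain ⟨h1, h2, h3⟩ := deleteCore_spec L g.radius hk (p := p) hg.data hg.balanced (by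
    intro y hy hyp
    rw [hg.points_eq, Multiset.mem_cons] at hy
    exact hmin y (hy.resolve_left hyp) hyp)
  obtain ⟨r1, r2, r3, r4⟩ := recluster_spec g.radius hk h1
  have hnd : (p ::ₘ Q).Nodup := hg.points_eq ▸ hg.data.nodup
  rw [Multiset.nodup_cons] at hnd
  refine ⟨r1, r2, ?_, ?_, ?_⟩
  · refine r3.trans ((Multiset.Nodup.ext h1.nodup hnd.2).2 fun q => (h2 q).trans ?_)
    rw [hg.points_eq, Multiset.mem_cons]
    exact ⟨fun h => h.1.resolve_left h.2, fun h => ⟨.inr h, fun hqp => hnd.1 (hqp ▸ h)⟩⟩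
  · have := hg.cost
    simp only [deletePoint, Guess.spent, Multiset.card_cons] at *
    push_cast at *
    linarith
  · have := hg.reclusterOps_le
    simp only [deletePoint, Guess.spent] at *
    omega

end Guesses

/-! ### All guesses together -/

section Run

variable {U : Type u}

/-- The operations spent by all insertions and deletions, for all guesses. -/
def totalSpent (gs : List (Guess U)) : ℕ := (gs.map Guess.spent).sum

theorem val_forGuesses (f : Guess U → Timed (Guess U)) (gs : List (Guess U)) :
    (forGuesses f gs).val = gs.map fun g => (f g).val := by
  induction gs with
  | nil => rfl
  | cons g gs ih => simp [forGuesses, ih]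

theorem ops_forGuesses {f : Guess U → Timed (Guess U)}
    (hf : ∀ g, (f g).val.spent = g.spent + (f g).ops) (gs : List (Guess U)) :
    (forGuesses f gs).ops + totalSpent gs = totalSpent (forGuesses f gs).val + gs.length := by
  induction gs with
  | nil => rfl
  | cons g gs ih =>
    simp only [forGuesses, totalSpent, val_step, val_bind, val_map, ops_step, ops_bind, ops_map,
      List.map_cons, List.sum_cons, List.length_cons, hf] at ih ⊢
    omega

variable {X : Set U} {L : Lifetimes U} {k : ℕ}

theorem IsDataset.finite_activeSet (hX : IsDataset X L) (t : ℕ) : (activeSet X L t).Finite :=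
  Set.Finite.of_injOn (f := L.arr) (t := Set.Iic t) (fun _ hp => hp.2.1)
    (hX.arr_injOn.mono fun _ hp => hp.1) (Set.finite_Iic t)

theorem IsDataset.card_le_ncard_activeSet (hX : IsDataset X L) {t : ℕ} {Q : Multiset U}
    (hQ : Q.Nodup) (hact : ∀ q ∈ Q, q ∈ activeSet X L t) : Q.card ≤ (activeSet X L t).ncard := by
  classical
  rw [← Multiset.toFinset_card_of_nodup hQ, ← Set.ncard_coe_finset]
  exact Set.ncard_le_ncard (fun q hq => hact q (by simpa using hq)) (hX.finite_activeSet t)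

theorem ncard_activeSet_le_maxActive {calls : List (Call U)} {c : Call U} (hc : c ∈ calls) :
    (activeSet X L c.time).ncard ≤ maxActive X L calls := by
  induction calls with
  | nil => simp at hc
  | cons c' cs ih =>
    simp only [maxActive, List.map_cons, List.foldr_cons] at ih ⊢
    rcases List.mem_cons.1 hc with rfl | hc
    · exact le_max_left _ _
    · exact (ih hc).trans (le_max_right _ _)

/-- What holds for the memory between two calls of `Update`, after `n` insertions. -/
structure Memory.Valid (X : Set U) (L : Lifetimes U) (k n : ℕ) (s : Memory U) : Prop where
  leftist : s.queue.Leftist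
  ordered : s.queue.Ordered L
  nodup : s.queue.points.Nodup
  subset : ∀ q ∈ s.queue.points, q ∈ X
  guesses : ∀ g ∈ s.guesses, g.Valid L k n s.queue.points

variable (X L k) in
theorem valid_startMemory (ε dmin dmax : ℝ) : (startMemory U ε dmin dmax).Valid X L k 0 := by
  refine ⟨trivial, trivial, by simp [startMemory, Heap.points],
    by simp [startMemory, Heap.points], fun g hg => ?_⟩
  obtain ⟨γ, -, rfl⟩ := List.mem_map.1 hg
  refine ⟨⟨by simp, by simp, by simp, by simp⟩, fun Bs Es hE => ?_, ?_, ?_, le_rfl⟩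
  · rw [List.nil_eq, List.append_eq_nil_iff] at hE
    simp [hE.2]
  · simp [Clustering.points, startMemory, Heap.points]
  · simp [Clustering.potential, potential, startMemory, Heap.points, Guess.spent]

variable [MetricSpace U]

theorem spent_insertPoint (p : U) (g : Guess U) :
    (insertPoint L k p g).val.spent = g.spent + (insertPoint L k p g).ops := by
  simp only [insertPoint, Guess.spent]
  omega

theorem spent_deletePoint (p : U) (g : Guess U) :
    (deletePoint L k p g).val.spent = g.spent + (deletePoint L k p g).ops := by
  simp only [deletePoint, Guess.spent]
  omega

/-- A bound for the operations that `Update` needs for a point, apart from those spent for the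
single guesses, when there are `N` guesses and at most `M` points at a time. -/
def overhead (N M : ℕ) : ℕ := N + 2 * Nat.log 2 M + 2

/-- Each deletion is paid for by the removal of a point from the queue. -/
theorem removeExpired_spec (hX : IsDataset X L) (hk : 1 ≤ k) (t M n m : ℕ) {s : Memory U}
    (hs : s.Valid X L k n) (hm : s.queue.size ≤ m) (hM : s.queue.size ≤ M) :
    let r := removeExpired L k t m s
    r.val.Valid X L k n ∧ r.val.queue.points ≤ s.queue.points ∧
      (∀ q ∈ r.val.queue.points, t < L.del q) ∧ r.val.guesses.length = s.guesses.length ∧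
      r.ops + totalSpent s.guesses + overhead s.guesses.length M * r.val.queue.size ≤
        totalSpent r.val.guesses + overhead s.guesses.length M * s.queue.size + 1 := by
  intro r
  induction m generalizing s with
  | zero =>
    have h0 : s.queue.points = 0 := by
      rw [← Multiset.card_eq_zero, Heap.card_points]
      omega
    refine ⟨hs, le_rfl, ?_, rfl, ?_⟩
    · simp [r, removeExpired, h0]
    · simp only [r, removeExpired, val_step, val_ret, ops_step, ops_ret]
      omega
  | succ m ih =>
    obtain ⟨queue, gs⟩ := s
    cases queue with
    | nil =>
      refine ⟨hs, le_rfl, by simp [r, removeExpired, Heap.points], rfl, ?_⟩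
      simp only [r, removeExpired, val_step, val_ret, ops_step, ops_ret]
      omega
    | node rk q hl hr =>
      obtain ⟨hleft, ⟨hqmin, hlo, hro⟩, hnd, hsub, hgs⟩ := hs
      obtain ⟨-, -, hll, hrl⟩ := id hleft
      simp only [Heap.points, Multiset.nodup_cons, Multiset.mem_cons] at hnd hsub hgs
      by_cases hdel : L.del q ≤ t
      · have hpts := Heap.points_merge L hl hr
        have hsize : (Heap.merge L hl hr).val.size = hl.size + hr.size := by
          rw [← Heap.card_points, hpts, Multiset.card_add, Heap.card_points, Heap.card_points]
        have hops := Heap.ops_merge_le L hl hr hll hrl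
        simp only [Heap.size] at hm hM
        have hlr := Heap.rank_le_log (m := M) hll (by omega)
        have hrr := Heap.rank_le_log (m := M) hrl (by omega)
        have hval := val_forGuesses (deletePoint L k q) gs
        have hsp := ops_forGuesses (spent_deletePoint (L := L) (k := k) q) gs
        set gs' := (forGuesses (deletePoint L k q) gs).val with hgs'
        have hlen : gs'.length = gs.length := by rw [hval, List.length_map]
        obtain ⟨a, b, c, d, e⟩ := ih (s := ⟨(Heap.merge L hl hr).val, gs'⟩)
          ⟨Heap.leftist_merge L _ _ hll hrl, Heap.ordered_merge L _ _ hlo hro, hpts ▸ hnd.2,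
            fun y hy => hsub y (.inr (hpts ▸ hy)), by
              rw [hval, hpts]
              intro g hg
              obtain ⟨g₀, hg₀, rfl⟩ := List.mem_map.1 hg
              exact deletePoint_spec L hk (hgs g₀ hg₀) fun y hy hyq =>
                hX.key_lt (hsub q (.inl rfl)) (hsub y (.inr hy)) (hqmin y hy) hyq⟩
          (by simp only [hsize]; omega) (by simp only [hsize]; omega)
        simp only [r, removeExpired, hdel, if_true, val_step, val_bind, ops_step, ops_bind]
        refine ⟨a, b.trans ?_, c, d.trans hlen, ?_⟩
        · rw [hpts]
          exact Multiset.le_cons_self _ _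
        · simp only [hlen, hsize] at e
          rw [← hgs']
          simp only [Heap.size]
          have hw : overhead gs.length M = gs.length + 2 * Nat.log 2 M + 2 := rfl
          rw [mul_add, mul_one]
          omega
      · have hr' : r = ⟨⟨Heap.node rk q hl hr, gs⟩, 1⟩ := by
          simp only [r, removeExpired, hdel, if_false]
          rfl
        rw [hr']
        refine ⟨⟨hleft, ⟨hqmin, hlo, hro⟩, Multiset.nodup_cons.2 hnd, ?_, hgs⟩, le_rfl, ?_, rfl, ?_⟩
        · simpa [Heap.points] using hsub
        · intro y hy
          rcases Multiset.mem_cons.1 hy with rfl | hy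
          · exact not_le.1 hdel
          · exact (not_le.1 hdel).trans_le (Lifetimes.del_le_of_key_le (hqmin y hy))
        · simp only
          omega

theorem update_spec (hX : IsDataset X L) (hk : 1 ≤ k) {M n : ℕ} {s : Memory U} {c : Call U}
    (hs : s.Valid X L k n) (hM : s.queue.size ≤ M) (hc : (activeSet X L c.time).ncard ≤ M)
    (harr : ∀ q ∈ s.queue.points, L.arr q ≤ c.time)
    (hp : ∀ p, c.point = some p → p ∈ X ∧ c.time = L.arr p)
    (hnew : ∀ p, c.point = some p → p ∉ s.queue.points) :
    let r := update L k c s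
    r.val.Valid X L k (n + 1) ∧ r.val.queue.size ≤ M ∧
      (∀ q ∈ r.val.queue.points, q ∈ s.queue.points ∨ c.point = some q) ∧
      r.val.guesses.length = s.guesses.length ∧
      r.ops + totalSpent s.guesses + overhead s.guesses.length M * r.val.queue.size ≤
        totalSpent r.val.guesses + overhead s.guesses.length M * s.queue.size +
          (2 * overhead s.guesses.length M + 3) := by
  intro r
  obtain ⟨h1, h2, h3, h4, h5⟩ := removeExpired_spec hX hk c.time M n s.queue.size hs le_rfl hM
  have h6 : (removeExpired L k c.time s.queue.size s).val.queue.size ≤ s.queue.size := by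
    simpa only [Heap.card_points] using Multiset.card_le_card h2
  obtain ⟨point, time⟩ := c
  cases point with
  | none =>
    simp only [r, update, val_step, val_bind, ops_step, ops_bind, val_ret, ops_ret]
    refine ⟨⟨h1.leftist, h1.ordered, h1.nodup, h1.subset,
      fun g hg => (h1.guesses g hg).mono (Nat.le_succ n)⟩, h6.trans hM,
      fun q hq => .inl (Multiset.mem_of_le h2 hq), h4, ?_⟩
    simp only at h5
    omega
  | some p =>
    simp only [r, update, val_step, val_bind, ops_step, ops_bind, val_map, ops_map]
    simp only at h1 h2 h3 h4 h5 h6 hc harr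
    set s' := (removeExpired L k time s.queue.size s).val
    obtain ⟨hpX, hpt⟩ := hp p rfl
    simp only at hpt
    have hpn : p ∉ s'.queue.points := fun h => hnew p rfl (Multiset.mem_of_le h2 h)
    have hpts := Heap.points_insert L p s'.queue
    have hnd : (p ::ₘ s'.queue.points).Nodup := Multiset.nodup_cons.2 ⟨hpn, h1.nodup⟩
    have hsub : ∀ q ∈ p ::ₘ s'.queue.points, q ∈ X := by
      rw [Multiset.forall_mem_cons]
      exact ⟨hpX, h1.subset⟩
    have hcard := (hX.card_le_ncard_activeSet (t := time) hnd (by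
      rw [Multiset.forall_mem_cons]
      refine ⟨⟨hpX, hpt.ge, hpt ▸ hX.arr_lt_del p hpX⟩, fun q hq => ⟨h1.subset q hq, ?_, h3 q hq⟩⟩
      exact harr q (Multiset.mem_of_le h2 hq))).trans hc
    rw [Multiset.card_cons, Heap.card_points] at hcard
    have hsize : (Heap.insert L p s'.queue).val.size = s'.queue.size + 1 := by
      rw [← Heap.card_points, hpts, Multiset.card_cons, Heap.card_points]
    have hops := Heap.ops_insert_le L p h1.leftist
    have hrank := Heap.rank_le_log h1.leftist hcard
    have hval := val_forGuesses (insertPoint L k p) s'.guesses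
    have hsp := ops_forGuesses (spent_insertPoint (L := L) (k := k) p) s'.guesses
    refine ⟨⟨Heap.leftist_insert L p h1.leftist, Heap.ordered_insert L p h1.ordered, hpts ▸ hnd,
      by rwa [hpts], ?_⟩, hsize ▸ hcard, ?_, ?_, ?_⟩
    · rw [hval, hpts]
      intro g hg
      obtain ⟨g₀, hg₀, rfl⟩ := List.mem_map.1 hg
      exact insertPoint_spec L hk (h1.guesses g₀ hg₀) hpn
    · rw [hpts, Multiset.forall_mem_cons]
      exact ⟨.inr rfl, fun q hq => .inl (Multiset.mem_of_le h2 hq)⟩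
    · rw [hval, List.length_map, h4]
    · have hw : overhead s.guesses.length M = s.guesses.length + 2 * Nat.log 2 M + 2 := rfl
      rw [hsize, mul_add, mul_one]
      omega

theorem runCalls_spec (hX : IsDataset X L) (hk : 1 ≤ k) {M : ℕ} (calls : List (Call U)) {n : ℕ}
    {s : Memory U} (hs : s.Valid X L k n) (hM : s.queue.size ≤ M)
    (hcalls : ∀ c ∈ calls, (activeSet X L c.time).ncard ≤ M)
    (hv : ValidCalls X L calls) (harr : ∀ c ∈ calls, ∀ q ∈ s.queue.points, L.arr q ≤ c.time)
    (hnew : ∀ c ∈ calls, ∀ p, c.point = some p → p ∉ s.queue.points) :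
    let r := runCalls L k calls s
    r.val.Valid X L k (n + calls.length) ∧ r.val.guesses.length = s.guesses.length ∧
      r.ops + totalSpent s.guesses ≤
        totalSpent r.val.guesses + overhead s.guesses.length M * s.queue.size +
          calls.length * (2 * overhead s.guesses.length M + 3) := by
  intro r
  induction calls generalizing n s with
  | nil =>
    refine ⟨hs, rfl, ?_⟩
    simp only [r, runCalls, val_ret, ops_ret]
    omega
  | cons c cs ih =>
    obtain ⟨hsort, harrival, honce⟩ := hv
    rw [List.map_cons, List.pairwise_cons] at hsort
    rw [List.forall_mem_cons] at hcalls harr hnew harrival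
    obtain ⟨h1, h2, h3, h4, h5⟩ :=
      update_spec hX hk hs hM hcalls.1 harr.1 harrival.1 hnew.1
    have honce' : (cs.filterMap Call.point).Nodup :=
      honce.sublist ((List.sublist_cons_self c cs).filterMap _)
    obtain ⟨a, b, d⟩ := ih (s := (update L k c s).val) h1 h2 hcalls.2
      ⟨hsort.2, harrival.2, honce'⟩ (fun c' hc' q hq => by
        rcases h3 q hq with hq | hq
        · exact harr.2 c' hc' q hq
        · rw [← (harrival.1 q hq).2]
          exact hsort.1 _ (List.mem_map_of_mem hc'))
      (fun c' hc' p hp hq => by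
        rcases h3 p hq with hq | hq
        · exact hnew.2 c' hc' p hp hq
        · rw [List.filterMap_cons_some hq, List.nodup_cons] at honce
          exact honce.1 (List.mem_filterMap.2 ⟨c', hc', hp⟩))
    refine ⟨?_, b.trans h4, ?_⟩
    · rw [List.length_cons, ← Nat.succ_add_eq_add_succ]
      exact a
    · simp only [r, runCalls, val_bind, ops_bind, List.length_cons]
      rw [h4] at d
      rw [add_mul, one_mul]
      omega

end Run

/-! ### The number of guesses -/

theorem length_guessRadii (ε dmin dmax : ℝ) : (guessRadii ε dmin dmax).length =
    (⌈Real.logb (1 + ε / 2) dmax⌉ + 1 - ⌊Real.logb (1 + ε / 2) dmin⌋).toNat := by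
  simp [guessRadii]

theorem one_le_length_guessRadii {ε dmin dmax : ℝ} (hε : 0 < ε) (h0 : 0 < dmin)
    (hle : dmin ≤ dmax) : 1 ≤ (guessRadii ε dmin dmax).length := by
  have h1 : Real.logb (1 + ε / 2) dmin ≤ Real.logb (1 + ε / 2) dmax :=
    Real.logb_le_logb_of_le (by linarith) h0 hle
  have h2 : ⌊Real.logb (1 + ε / 2) dmin⌋ ≤ ⌈Real.logb (1 + ε / 2) dmax⌉ :=
    (Int.floor_mono h1).trans (Int.floor_le_ceil _)
  rw [length_guessRadii]
  omega

theorem length_guessRadii_le {ε E dmin dmax : ℝ} (hε : 0 < ε) (hE : ε ≤ E) (h0 : 0 < dmin)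
    (hle : dmin ≤ dmax) :
    ((guessRadii ε dmin dmax).length : ℝ) ≤ (3 + E) * (1 + Real.log (dmax / dmin) / ε) := by
  have h1 := one_le_length_guessRadii hε h0 hle
  have h2 : ((guessRadii ε dmin dmax).length : ℤ) =
      ⌈Real.logb (1 + ε / 2) dmax⌉ + 1 - ⌊Real.logb (1 + ε / 2) dmin⌋ := by
    rw [length_guessRadii] at h1 ⊢
    omega
  have h3 : ((guessRadii ε dmin dmax).length : ℝ) =
      ⌈Real.logb (1 + ε / 2) dmax⌉ + 1 - ⌊Real.logb (1 + ε / 2) dmin⌋ := by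
    exact_mod_cast congrArg (Int.cast : ℤ → ℝ) h2
  have h4 := Int.ceil_lt_add_one (Real.logb (1 + ε / 2) dmax)
  have h5 := Int.sub_one_lt_floor (Real.logb (1 + ε / 2) dmin)
  have h6 : Real.logb (1 + ε / 2) dmax - Real.logb (1 + ε / 2) dmin =
      Real.log (dmax / dmin) / Real.log (1 + ε / 2) := by
    rw [Real.log_div (by linarith) h0.ne', sub_div]
    rfl
  have hlog : 0 ≤ Real.log (dmax / dmin) := Real.log_nonneg ((one_le_div h0).2 hle)
  -- `log (1 + β) ≥ β / (1 + β)`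
  have h7 : ε / (2 + E) ≤ Real.log (1 + ε / 2) := by
    refine le_trans ?_ (Real.one_sub_inv_le_log_of_pos (by linarith : 0 < 1 + ε / 2))
    have : 1 - (1 + ε / 2)⁻¹ = ε / (2 + ε) := by
      field_simp
      ring
    rw [this]
    exact div_le_div_of_nonneg_left hε.le (by linarith) (by linarith)
  have h8 : Real.log (dmax / dmin) / Real.log (1 + ε / 2) ≤
      (2 + E) * (Real.log (dmax / dmin) / ε) := by
    refine (div_le_div_of_nonneg_left hlog (div_pos hε (by linarith)) h7).trans_eq ?_
    rw [div_div_eq_mul_div]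
    ring
  have h9 : 0 ≤ Real.log (dmax / dmin) / ε := div_nonneg hlog hε.le
  nlinarith

end LifetimeKCenter

/-! ### The running time -/

theorem mainTheorem2 :
    ∃ C₀ : ℝ, 0 < C₀ ∧ ∀ E : ℝ, 0 < E → ∃ C : ℝ, 0 < C ∧
      ∀ (U : Type u) [MetricSpace U] (X : Set U) (L : Lifetimes U) (dmin dmax ε : ℝ) (k : ℕ)
        (calls : List (Call U)),
        IsDataset X L →
        IsLeast (pairDistances X) dmin → IsGreatest (pairDistances X) dmax →
        0 < ε → ε ≤ E → 1 ≤ k →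
        ValidCalls X L calls →
          ((runCalls L k calls (startMemory U ε dmin dmax)).ops : ℝ) ≤
              C * (calls.length *
                (Real.log (maxActive X L calls) + (1 + Real.log (dmax / dmin) / ε) * k)) ∧
          (ε ≤ Real.log (dmax / dmin) →
            ((runCalls L k calls (startMemory U ε dmin dmax)).ops : ℝ) ≤
              C * (calls.length *
                (Real.log (maxActive X L calls) + Real.log (dmax / dmin) / ε * k))) ∧
          ∀ g ∈ (runCalls L k calls (startMemory U ε dmin dmax)).val.guesses,
            (g.insertOps : ℝ) ≤ C₀ * (calls.length * k) ∧
            (g.deleteOps : ℝ) ≤ C₀ * (calls.length * k) ∧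
            (g.reclusterOps : ℝ) ≤ C₀ * (calls.length * k) := by
  refine ⟨54, by norm_num, fun E hE => ⟨126 * (3 + E), by positivity, ?_⟩⟩
  intro U _ X L dmin dmax ε k calls hX hmin hmax hε hεE hk hv
  have hle : dmin ≤ dmax := hmin.2 hmax.1
  have h0 : 0 < dmin := by
    obtain ⟨x, -, y, -, hxy, rfl⟩ := hmin.1
    exact dist_pos.2 hxy
  obtain ⟨hr, hlen, hops⟩ := runCalls_spec hX hk (M := maxActive X L calls) calls
    (valid_startMemory X L k ε dmin dmax) (Nat.zero_le _)
    (fun c hc => ncard_activeSet_le_maxActive hc) hv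
    (by simp [startMemory, Heap.points]) (by simp [startMemory, Heap.points])
  rw [zero_add] at hr
  set r := runCalls L k calls (startMemory U ε dmin dmax)
  set M := maxActive X L calls
  set n := calls.length
  have hN : (startMemory U ε dmin dmax).guesses.length = (guessRadii ε dmin dmax).length := by
    simp [startMemory]
  have hN1 := one_le_length_guessRadii hε h0 hle
  have hN2 := length_guessRadii_le hε hεE h0 hle
  rw [hN] at hlen hops
  set N := (guessRadii ε dmin dmax).length
  have hspent : totalSpent r.val.guesses ≤ N * (54 * k * n) := by
    rw [totalSpent, ← hlen, ← smul_eq_mul, ← List.length_map (as := r.val.guesses) Guess.spent]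
    refine List.sum_le_card_nsmul _ _ fun z hz => ?_
    obtain ⟨g, hg, rfl⟩ := List.mem_map.1 hz
    exact (hr.guesses g hg).spent_le
  have hlog : (Nat.log 2 M : ℝ) ≤ 2 * Real.log M := by
    have h1 := Real.natLog_le_logb M 2
    have h2 : (0.5 : ℝ) ≤ Real.log 2 := by linarith [Real.log_two_gt_d9]
    have h3 : 0 ≤ Real.log M := Real.log_natCast_nonneg M
    refine h1.trans ?_
    rw [Real.logb, Nat.cast_ofNat, div_le_iff₀ (by linarith)]
    nlinarith
  have hlogM : 0 ≤ Real.log M := Real.log_natCast_nonneg M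
  have htotal : (r.ops : ℝ) ≤ n * (63 * (k * N) + 8 * Real.log M) := by
    have h1 : r.ops ≤ N * (54 * k * n) + n * (2 * overhead N M + 3) := by
      have hq : (startMemory U ε dmin dmax).queue.size = 0 := rfl
      rw [hq, mul_zero] at hops
      omega
    have h2 : (r.ops : ℝ) ≤ N * (54 * k * n) + n * (2 * (N + 2 * Nat.log 2 M + 2) + 3) := by
      exact_mod_cast h1
    have h3 : (1 : ℝ) ≤ k := by exact_mod_cast hk
    have h4 : (1 : ℝ) ≤ N := by exact_mod_cast hN1
    have h5 : (N : ℝ) ≤ k * N := le_mul_of_one_le_left (by linarith) h3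
    have h6 : (n : ℝ) * (54 * (k * N) + (2 * (N + 2 * Nat.log 2 M + 2) + 3)) ≤
        n * (63 * (k * N) + 8 * Real.log M) :=
      mul_le_mul_of_nonneg_left (by linarith) (Nat.cast_nonneg n)
    linarith
  -- the two bounds differ only in the bound `ρ` for the number of guesses, up to a factor
  have hmain : ∀ ρ : ℝ, (N : ℝ) ≤ 2 * (3 + E) * ρ →
      (r.ops : ℝ) ≤ 126 * (3 + E) * (n * (Real.log M + ρ * k)) := by
    intro ρ hρ
    have h1 : (k : ℝ) * N ≤ k * (2 * (3 + E) * ρ) :=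
      mul_le_mul_of_nonneg_left hρ (Nat.cast_nonneg k)
    have h2 : 8 * Real.log M ≤ 126 * (3 + E) * Real.log M :=
      mul_le_mul_of_nonneg_right (by linarith) hlogM
    have h3 : (n : ℝ) * (63 * (k * N) + 8 * Real.log M) ≤
        n * (126 * (3 + E) * (Real.log M + ρ * k)) :=
      mul_le_mul_of_nonneg_left (by linarith) (Nat.cast_nonneg n)
    linarith
  have hΔ : 0 ≤ Real.log (dmax / dmin) / ε :=
    div_nonneg (Real.log_nonneg ((one_le_div h0).2 hle)) hε.le
  refine ⟨hmain _ ?_, fun h => hmain _ ?_, fun g hg => ?_⟩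
  · have : 0 ≤ (3 + E) * (1 + Real.log (dmax / dmin) / ε) := by positivity
    linarith
  · have : 1 ≤ Real.log (dmax / dmin) / ε := (one_le_div hε).2 h
    nlinarith
  · have h1 := (hr.guesses g hg).spent_le
    have h2 := (hr.guesses g hg).reclusterOps_le
    have h3 : (g.spent : ℝ) ≤ 54 * (n * k) := by
      have : (g.spent : ℝ) ≤ 54 * k * n := by exact_mod_cast h1
      linarith
    refine ⟨le_trans ?_ h3, le_trans ?_ h3, le_trans ?_ h3⟩
    · exact_mod_cast Nat.le_add_right _ _
    · exact_mod_cast Nat.le_add_left _ _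
    · exact_mod_cast h2
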